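/- **Artin families.** Let $k$ be an algebraically closed field of characteristic zero, let $R$ be a normal two-dimensional domain which is a quotient of a formal power series ring $k[[x_1,\dots,x_n]]$, and put $X=\mathrm{Spec}(R)$. Let $f:X_1\to X$ be a good resolution, i.e., a proper birational morphism with $X_1$ regular, which is an isomorphism off $\mathrm{Sing}(X)$ and whose exceptional set has as irreducible components regular curves $E_1,\dots,E_m$ such that no point lies on three of them and any two of them meet transversally at every common point. An *Artin family* for these data consists of - a complete discrete valuation ring $\Lambda$ with residue field $k$ and fraction field of characteristic zero; put $U=\mathrm{Spec}(\Lambda)=\{\gamma,\mathbf o\}$, with $\gamma$ the generic and $\mathbf o$ the closed point; - a complete normal Noetherian local $\Lambda$-algebra $\tilde R$ of dimension $3$; put $\mathscr X=\mathrm{Spec}(\tilde R)$ and let $\pi:\mathscr X\to U$ be the natural map; - a section $s:U\to\mathscr X$ of $\pi$, with image $S=V(I)$, where $I=\ker(\tilde R\to\Lambda)$; - a resolution of singularities (proper, birational, with regular source) $\tilde f:\tilde{\mathscr X}\to\mathscr X$ which is an isomorphism off $S$, such that $\tilde f^{-1}(S)$ is the union of integral surfaces $\tilde E_1,\dots,\tilde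 E_m$, smooth over $U$, with normal crossings; - a local subring $R_0\subset R$ whose normalization is $R$, such that the closed fiber of $\pi$ is $X_0=\mathrm{Spec}(R_0)$ (over $k$), the closed fiber of $\pi\tilde f$ is $X_1$ (over $X_0$, where $X_1\to X\to X_0$), and the scheme-theoretic intersection of $\tilde E_i$ with this closed fiber is $E_i$ for all $i$. **Arcs.** For a field $K$, an *$S$-arc* is a morphism $\mathrm{Spec}(K[[t]])\to\mathscr X$ sending the closed point to a point of $S$. It is *over $U$* if the composition with $\pi$ factors through the projection $\mathrm{Spec}(K[[t]])\to\mathrm{Spec}(K)$ given by $K\subset K[[t]]$. Given a field extension $K\subseteq L$, an $S$-arc $\alpha:\mathrm{Spec}(K[[t]])\to\mathscr X$ is a *direct specialization* of an $S$-arc $\beta:\mathrm{Spec}(L((u))[[t]])\to\mathscr X$ if there is a morphism $\mathrm{Spec}(K[[u]][[t]])\to\mathscr X$ which induces $\alpha$ for $u=0$ and induces $\beta$ via $K[[u]][[t]]\subseteq L((u))[[t]]$. A triple $(R',I',\Lambda')$, where $R'$ is an algebra over $\Lambda'$ and $I'$ an ideal of $R'$, is *nice* if $\Lambda'$ and $R'$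 are Noetherian, $R'$ is $I'$-adically complete and $\Lambda'\to R'/I'$ is an isomorphism. The *arc scheme* $\mathscr X_\infty^{(s)}$ is the spectrum of the $\Lambda$-algebra $R_\infty$ that represents the functor sending a $\Lambda$-algebra $A$ to the set of $\Lambda$-algebra homomorphisms $\tilde R\to A[[t]]$ mapping $I$ into $(t)$. *Condition (NO)* says that every irreducible component of $\mathscr X_\infty^{(s)}$ meets the fiber of $\mathscr X_\infty^{(s)}\to U$ over $\gamma$, i.e., none lies entirely over $\mathbf o$. **Theorem.** For every Artin family as above (with $k$ of characteristic zero): (D) For every field $K$, every $S$-arc $\phi:\mathrm{Spec}(K[[t]])\to\mathscr X$ with image in $X_0$ is a direct specialization of an $S$-arc $\psi:\mathrm{Spec}(L((u))[[t]])\to\mathscr X$, for a suitable field $L\supseteq K$, such that $\mathrm{Im}(\psi)\not\subseteq X_0$. If $\phi$ is over $U$, then $\psi$ can moreover be taken over $U$. Consequently, the associated triple $(\tilde R,I,\Lambda)$, which is nice, satisfies Condition (NO). -/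

import Mathlib

open CategoryTheory AlgebraicGeometry

universe u

namespace ArtinArcs

noncomputable section

/-! ### Nice triples, arcs and direct specializations -/

/-- A nice triple `(R, I, Λ)`: Noetherian rings, `R` an `I`-adically complete `Λ`-algebra such that
`Λ → R → R ⧸ I` is an isomorphism. It corresponds to `Spec R → Spec Λ` with the section whose image
is `S = V(I)`. -/
structure IsNiceTriple (Λ R : Type u) [CommRing Λ] [CommRing R] [Algebra Λ R] (I : Ideal R) :
    Prop where
  noetherian_base : IsNoetherianRing Λ
  noetherian : IsNoetherianRing R
  complete : IsAdicComplete I R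
  bijective : Function.Bijective ((Ideal.Quotient.mk I).comp (algebraMap Λ R))

/-- The morphism `Spec K⟦t⟧ → Spec R` given by `φ` is an arc centred on `S = V(I)`: it maps the
closed point `t = 0` into `S`. -/
def IsSArc {R : Type u} [CommRing R] (I : Ideal R) {K : Type u} [Field K]
    (φ : R →+* PowerSeries K) : Prop :=
  ∀ r ∈ I, PowerSeries.constantCoeff (φ r) = 0

/-- The arc `φ` is a morphism over `Spec Λ`, for some `Λ`-algebra structure on the field `K`:
the elements of `Λ` are sent to constant power series. -/
def IsArcOverBase (Λ : Type u) {R : Type u} [CommRing Λ] [CommRing R] [Algebra Λ R]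
    {K : Type u} [Field K] (φ : R →+* PowerSeries K) : Prop :=
  ∀ a : Λ, ∃ c : K, φ (algebraMap Λ R a) = PowerSeries.C c

/-- The set-theoretic image of the morphism `Spec K⟦t⟧ → Spec R` given by `φ`. -/
def arcImage {R : Type u} [CommRing R] {K : Type u} [Field K] (φ : R →+* PowerSeries K) :
    Set (PrimeSpectrum R) :=
  Set.range (PrimeSpectrum.comap φ)

/-- The closed fiber `X₀` of `Spec R → Spec Λ`, for a local ring `Λ`. -/
def closedFiber (Λ R : Type u) [CommRing Λ] [IsLocalRing Λ] [CommRing R] [Algebra Λ R] :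
    Set (PrimeSpectrum R) :=
  PrimeSpectrum.comap (algebraMap Λ R) ⁻¹' {IsLocalRing.closedPoint Λ}

/-- The inclusion `K⟦u⟧ → L((u))` for a field extension `L / K`. -/
def toLaurent (K L : Type u) [Field K] [Field L] [Algebra K L] :
    PowerSeries K →+* LaurentSeries L :=
  (HahnSeries.ofPowerSeries ℤ L).comp (PowerSeries.map (algebraMap K L))

/-- The `S`-arc `α : Spec K⟦t⟧ → Spec R` is a direct specialization of the
`S`-arc `β : Spec L((u))⟦t⟧ → Spec R`: there is a morphism `Spec K⟦u, t⟧ → Spec R`, where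
`K⟦u, t⟧ = K⟦u⟧⟦t⟧`, which induces `α` for `u = 0` and induces `β` by the extension of coefficients
`K⟦u⟧ ⊆ L((u))`. -/
structure IsDirectSpecialization {R : Type u} [CommRing R] (I : Ideal R)
    {K L : Type u} [Field K] [Field L] [Algebra K L]
    (α : R →+* PowerSeries K) (β : R →+* PowerSeries (LaurentSeries L)) : Prop where
  isSArc_left : IsSArc I α
  isSArc_right : IsSArc I β
  exists_family : ∃ Φ : R →+* PowerSeries (PowerSeries K),
    (PowerSeries.map (PowerSeries.constantCoeff (R := K))).comp Φ = α ∧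
    (PowerSeries.map (toLaurent K L)).comp Φ = β

/-! ### The arc scheme -/

/-- The relations between the coefficients `X (n, r)` of `tⁿ` in the universal `Λ`-algebra
homomorphism `r ↦ ∑ₙ X (n, r) tⁿ` from `R` to power series that sends `I` into the ideal `(t)`. -/
inductive ArcRel (Λ R : Type u) [CommRing Λ] [CommRing R] [Algebra Λ R] (I : Ideal R) :
    MvPolynomial (ℕ × R) Λ → Prop
  | add (n : ℕ) (r r' : R) :
      ArcRel Λ R I (MvPolynomial.X (n, r + r') - (MvPolynomial.X (n, r) + MvPolynomial.X (n, r')))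
  | mul (n : ℕ) (r r' : R) :
      ArcRel Λ R I (MvPolynomial.X (n, r * r') -
        ∑ p ∈ Finset.HasAntidiagonal.antidiagonal n, MvPolynomial.X (p.1, r) * MvPolynomial.X (p.2, r'))
  | algebraMap_zero (a : Λ) :
      ArcRel Λ R I (MvPolynomial.X (0, algebraMap Λ R a) - MvPolynomial.C a)
  | algebraMap_succ (n : ℕ) (a : Λ) :
      ArcRel Λ R I (MvPolynomial.X (n + 1, algebraMap Λ R a))
  | center (r : R) (hr : r ∈ I) : ArcRel Λ R I (MvPolynomial.X (0, r))

/-- The `Λ`-algebra `R_∞`, the coordinate ring of the scheme of arcs centred on `S = V(I)`; it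
represents the functor sending a `Λ`-algebra `A` to the set of `Λ`-algebra homomorphisms
`R → A⟦t⟧` sending `I` into `(t)`, see `ArcAlgebra.homEquiv`. -/
abbrev ArcAlgebra (Λ R : Type u) [CommRing Λ] [CommRing R] [Algebra Λ R] (I : Ideal R) : Type u :=
  MvPolynomial (ℕ × R) Λ ⧸ Ideal.span {p | ArcRel Λ R I p}

namespace ArcAlgebra

variable {Λ R : Type u} [CommRing Λ] [CommRing R] [Algebra Λ R] {I : Ideal R}

/-- The coefficient of `tⁿ` in the image of `r` under the universal arc. -/
def coeff (I : Ideal R) (n : ℕ) (r : R) : ArcAlgebra Λ R I :=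
  Ideal.Quotient.mk _ (MvPolynomial.X (n, r))

theorem mk_eq_zero_of_rel {p : MvPolynomial (ℕ × R) Λ} (h : ArcRel Λ R I p) :
    (Ideal.Quotient.mk (Ideal.span {p | ArcRel Λ R I p})) p = 0 :=
  Ideal.Quotient.eq_zero_iff_mem.2 (Ideal.subset_span h)

theorem coeff_add (n : ℕ) (r r' : R) :
    coeff (Λ := Λ) I n (r + r') = coeff I n r + coeff I n r' := by
  have h := mk_eq_zero_of_rel (ArcRel.add (Λ := Λ) (I := I) n r r')
  rw [map_sub, map_add, sub_eq_zero] at h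
  exact h

theorem coeff_mul (n : ℕ) (r r' : R) :
    coeff (Λ := Λ) I n (r * r') =
      ∑ p ∈ Finset.HasAntidiagonal.antidiagonal n, coeff I p.1 r * coeff I p.2 r' := by
  have h := mk_eq_zero_of_rel (ArcRel.mul (Λ := Λ) (I := I) n r r')
  rw [map_sub, map_sum, sub_eq_zero] at h
  simp only [map_mul] at h
  exact h

theorem coeff_algebraMap (n : ℕ) (a : Λ) :
    coeff (Λ := Λ) I n (algebraMap Λ R a) = if n = 0 then algebraMap Λ _ a else 0 := by
  cases n with
  | zero =>
    have h := mk_eq_zero_of_rel (ArcRel.algebraMap_zero (R := R) (I := I) a)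
    rw [map_sub, sub_eq_zero] at h
    rw [if_pos rfl]
    exact h
  | succ n =>
    rw [if_neg n.succ_ne_zero]
    exact mk_eq_zero_of_rel (ArcRel.algebraMap_succ (R := R) (I := I) n a)

theorem coeff_center (r : R) (hr : r ∈ I) : coeff (Λ := Λ) I 0 r = 0 :=
  mk_eq_zero_of_rel (ArcRel.center r hr)

/-- The arc with values in `A` given by an `A`-valued point of the arc scheme. -/
def toArc {A : Type u} [CommRing A] [Algebra Λ A] (f : ArcAlgebra Λ R I →ₐ[Λ] A) :
    R →ₐ[Λ] PowerSeries A :=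
  AlgHom.ofLinearMap
    { toFun := fun r => PowerSeries.mk fun n => f (coeff I n r)
      map_add' := fun r r' => by ext n; simp [coeff_add]
      map_smul' := fun a r => by
        ext n
        rw [Algebra.smul_def, PowerSeries.coeff_smul]
        simp only [PowerSeries.coeff_mk, coeff_mul, RingHom.id_apply, map_sum, map_mul,
          coeff_algebraMap]
        rw [Finset.sum_eq_single (0, n)]
        · simp [Algebra.smul_def]
        · rintro ⟨i, j⟩ hij hne
          have hi : i ≠ 0 := by
            rintro rfl
            simp only [Finset.HasAntidiagonal.mem_antidiagonal, zero_add] at hij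
            exact hne (by rw [hij])
          simp [hi]
        · simp }
    (by
      ext n
      have h := coeff_algebraMap (R := R) (I := I) n (1 : Λ)
      rw [map_one] at h
      simp only [LinearMap.coe_mk, AddHom.coe_mk, PowerSeries.coeff_mk, h, PowerSeries.coeff_one]
      split_ifs <;> simp)
    (fun r r' => by
      ext n
      simp [coeff_mul, PowerSeries.coeff_mul])

theorem toArc_center {A : Type u} [CommRing A] [Algebra Λ A] (f : ArcAlgebra Λ R I →ₐ[Λ] A)
    (r : R) (hr : r ∈ I) : PowerSeries.constantCoeff (toArc f r) = 0 := by
  rw [← PowerSeries.coeff_zero_eq_constantCoeff_apply]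
  simp [toArc, coeff_center r hr]

/-- The `A`-valued point of the arc scheme given by an arc with values in `A`. -/
def ofArc {A : Type u} [CommRing A] [Algebra Λ A] (φ : R →ₐ[Λ] PowerSeries A)
    (hφ : ∀ r ∈ I, PowerSeries.constantCoeff (φ r) = 0) : ArcAlgebra Λ R I →ₐ[Λ] A :=
  Ideal.Quotient.liftₐ _
    (MvPolynomial.aeval fun p : ℕ × R => PowerSeries.coeff p.1 (φ p.2)) (by
      intro p hp
      have hle : Ideal.span {p | ArcRel Λ R I p} ≤ RingHom.ker
          (MvPolynomial.aeval (R := Λ) fun p : ℕ × R => PowerSeries.coeff p.1 (φ p.2)) := by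
        rw [Ideal.span_le]
        rintro q hq
        rw [SetLike.mem_coe, RingHom.mem_ker]
        cases hq with
        | add n r r' => simp
        | mul n r r' => simp [PowerSeries.coeff_mul]
        | algebraMap_zero a =>
          simp [PowerSeries.algebraMap_apply]
        | algebraMap_succ n a =>
          simp [PowerSeries.algebraMap_apply]
        | center r hr => simpa using hφ r hr
      exact hle hp)

theorem ofArc_coeff {A : Type u} [CommRing A] [Algebra Λ A] (φ : R →ₐ[Λ] PowerSeries A)
    (hφ : ∀ r ∈ I, PowerSeries.constantCoeff (φ r) = 0) (n : ℕ) (r : R) :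
    ofArc φ hφ (coeff I n r) = PowerSeries.coeff n (φ r) :=
  MvPolynomial.aeval_X (R := Λ) (fun p : ℕ × R => PowerSeries.coeff p.1 (φ p.2)) (n, r)

/-- The functor of points of `ArcAlgebra`: for every `Λ`-algebra `A`, its `A`-valued points are the
`Λ`-algebra homomorphisms `R → A⟦t⟧` sending `I` into `(t)`. -/
def homEquiv (A : Type u) [CommRing A] [Algebra Λ A] :
    (ArcAlgebra Λ R I →ₐ[Λ] A) ≃
      {φ : R →ₐ[Λ] PowerSeries A // ∀ r ∈ I, PowerSeries.constantCoeff (φ r) = 0} where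
  toFun f := ⟨toArc f, toArc_center f⟩
  invFun φ := ofArc φ.1 φ.2
  left_inv f := by
    apply Ideal.Quotient.algHom_ext
    apply MvPolynomial.algHom_ext
    rintro ⟨n, r⟩
    refine (ofArc_coeff (toArc f) (toArc_center f) n r).trans ?_
    simp only [toArc, AlgHom.ofLinearMap_apply, LinearMap.coe_mk, AddHom.coe_mk,
      PowerSeries.coeff_mk]
    rfl
  right_inv φ := by
    apply Subtype.ext
    ext r n
    simp only [toArc, AlgHom.ofLinearMap_apply, LinearMap.coe_mk, AddHom.coe_mk,
      PowerSeries.coeff_mk, ofArc_coeff]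

end ArcAlgebra

/-- Condition (NO) for the triple `(R, I, Λ)` over a domain `Λ`: every irreducible component of the
arc scheme `Spec R_∞` meets the fiber over the generic point of `Spec Λ`. -/
def ConditionNO (Λ R : Type u) [CommRing Λ] [IsDomain Λ] [CommRing R] [Algebra Λ R]
    (I : Ideal R) : Prop :=
  ∀ Z ∈ irreducibleComponents (PrimeSpectrum (ArcAlgebra Λ R I)),
    (Z ∩ PrimeSpectrum.comap (algebraMap Λ (ArcAlgebra Λ R I)) ⁻¹' {⊥}).Nonempty

/-! ### Resolutions of singularities -/

/-- A scheme is regular if all its local rings are regular. -/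
def IsRegularScheme (X : Scheme.{u}) : Prop :=
  ∀ x : X, IsRegularLocalRing (X.presheaf.stalk x)

/-- The singular locus of a scheme. -/
def singularLocus (X : Scheme.{u}) : Set X :=
  {x | ¬ IsRegularLocalRing (X.presheaf.stalk x)}

/-- `f : Y ⟶ X` is an isomorphism off the (closed) subset `Z` of `X`. -/
def IsIsoOff {X Y : Scheme.{u}} (f : Y ⟶ X) (Z : Set X) : Prop :=
  ∀ V : X.Opens, Disjoint (V : Set X) Z → IsIso (f ∣_ V)

/-- `f : Y ⟶ X` is a birational morphism: an isomorphism over a dense open subset of `X` with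
dense inverse image. -/
def IsBirational {X Y : Scheme.{u}} (f : Y ⟶ X) : Prop :=
  ∃ V : X.Opens, Dense (V : Set X) ∧ Dense ((f ⁻¹ᵁ V : Y.Opens) : Set Y) ∧ IsIso (f ∣_ V)

/-- A resolution of singularities: a proper birational morphism from a regular scheme. -/
structure IsResolution {X Y : Scheme.{u}} (f : Y ⟶ X) : Prop where
  regular : IsRegularScheme Y
  proper : IsProper f
  birational : IsBirational f

/-- The exceptional set of a morphism: the points at which it is not a local isomorphism. -/
def exceptionalSet {X Y : Scheme.{u}} (f : Y ⟶ X) : Set Y :=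
  {y | ¬ ∃ W : Y.Opens, y ∈ W ∧ IsOpenImmersion (W.ι ≫ f)}

/-- The ideal, in the local ring of `X` at `x`, of the closed subscheme `j : Z ⟶ X`: it is generated
by the germs of the sections of `𝒪_X` near `x` that vanish on `Z`. -/
def idealAt {X Z : Scheme.{u}} (j : Z ⟶ X) (x : X) : Ideal (X.presheaf.stalk x) :=
  Ideal.span {g | ∃ (V : X.Opens) (hx : x ∈ V) (a : Γ(X, V)),
    (j.app V).hom a = 0 ∧ (X.presheaf.germ V x hx).hom a = g}

/-- `f : X₁ ⟶ X` is a good resolution of the singularities of a surface `X`, whose exceptional set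
has as irreducible components the distinct regular curves `j i : E i ⟶ X₁`. -/
structure IsGoodResolution {X X₁ : Scheme.{u}} (f : X₁ ⟶ X) {m : ℕ} {E : Fin m → Scheme.{u}}
    (j : ∀ i, E i ⟶ X₁) : Prop extends IsResolution f where
  isIsoOff : IsIsoOff f (singularLocus X)
  closedImmersion : ∀ i, IsClosedImmersion (j i)
  curve_integral : ∀ i, IsIntegral (E i)
  curve_regular : ∀ i, IsRegularScheme (E i)
  curve_dim : ∀ i, topologicalKrullDim (E i) = 1
  distinct : Function.Injective fun i => Set.range (j i)
  exceptional : exceptionalSet f = ⋃ i, Set.range (j i)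
  no_triple_point : ∀ i₁ i₂ i₃, i₁ ≠ i₂ → i₁ ≠ i₃ → i₂ ≠ i₃ →
    Set.range (j i₁) ∩ Set.range (j i₂) ∩ Set.range (j i₃) = ∅
  transversal : ∀ i₁ i₂, i₁ ≠ i₂ → ∀ x ∈ Set.range (j i₁) ∩ Set.range (j i₂),
    idealAt (j i₁) x ⊔ idealAt (j i₂) x = IsLocalRing.maximalIdeal (X₁.presheaf.stalk x)

/-- The closed subschemes `j i : E i ⟶ Y` have normal crossings: at each point `x` of `Y`, those
containing `x` have local equations that form part of a regular system of parameters, i.e., that are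
linearly independent in the cotangent space at `x`. -/
def HasNormalCrossings {Y : Scheme.{u}} {m : ℕ} {E : Fin m → Scheme.{u}} (j : ∀ i, E i ⟶ Y) :
    Prop :=
  ∀ x : Y, ∃ g : Fin m → IsLocalRing.maximalIdeal (Y.presheaf.stalk x),
    (∀ i, x ∈ Set.range (j i) → idealAt (j i) x = Ideal.span {(g i : Y.presheaf.stalk x)}) ∧
    LinearIndependent (IsLocalRing.ResidueField (Y.presheaf.stalk x))
      (fun i : {i // x ∈ Set.range (j i)} =>
        ((IsLocalRing.maximalIdeal (Y.presheaf.stalk x)).toCotangent (g i) :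
          IsLocalRing.CotangentSpace (Y.presheaf.stalk x)))

/-! ### Artin families -/

/-- An Artin family of surface singularities. Here `k` is an algebraically closed field,
`X = Spec R` is a normal algebroid surface over `k` with a good resolution `f : X₁ ⟶ X`,
`Λ` is a complete discrete valuation ring with residue field `k` and fraction field of
characteristic zero, `U = Spec Λ`, and `𝒳 = Spec Rt ⟶ U` is the family, with `Rt` a complete normal
Noetherian local domain of dimension three. -/
structure ArtinFamily (k R Λ Rt : Type u)
    [Field k] [IsAlgClosed k] [CommRing R] [IsDomain R] [IsIntegrallyClosed R] [Algebra k R]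
    [CommRing Λ] [IsDomain Λ] [IsDiscreteValuationRing Λ] [Algebra Λ k]
    [CommRing Rt] [IsDomain Rt] [IsIntegrallyClosed Rt] [IsNoetherianRing Rt] [IsLocalRing Rt]
    [Algebra Λ Rt] where
  /-- `R` is a quotient of a formal power series ring over `k` -/
  algebroid : ∃ (n : ℕ) (q : MvPowerSeries (Fin n) k →ₐ[k] R), Function.Surjective q
  dim_R : ringKrullDim R = 2
  /-- the good resolution of `X` and the components of its exceptional set -/
  X₁ : Scheme.{u}
  f : X₁ ⟶ Spec (CommRingCat.of R)
  m : ℕ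
  E : Fin m → Scheme.{u}
  j : ∀ i, E i ⟶ X₁
  goodResolution : IsGoodResolution f j
  /-- `Λ` is complete, with residue field `k` and fraction field of characteristic zero -/
  complete_base : IsAdicComplete (IsLocalRing.maximalIdeal Λ) Λ
  residueField : Function.Surjective (algebraMap Λ k)
  charZero_fractionRing : CharZero (FractionRing Λ)
  complete : IsAdicComplete (IsLocalRing.maximalIdeal Rt) Rt
  dim_Rt : ringKrullDim Rt = 3
  /-- the section `U ⟶ 𝒳` -/
  s : Rt →ₐ[Λ] Λ
  /-- the resolution of `𝒳` -/
  Xt : Scheme.{u}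
  ft : Xt ⟶ Spec (CommRingCat.of Rt)
  resolution : IsResolution ft
  /-- the local subring of `R` whose normalization is `R` -/
  R₀ : Subring R
  isLocalRing_R₀ : IsLocalRing R₀
  isFractionRing_R₀ : IsFractionRing R₀ (FractionRing R)
  isIntegralClosure_R₀ : IsIntegralClosure R R₀ (FractionRing R)
  /-- the resolution of `𝒳` is an isomorphism off the image `S` of the section, and the inverse
  image of `S` is a union of surfaces, smooth over `U`, with normal crossings -/
  isIsoOff : IsIsoOff ft (PrimeSpectrum.zeroLocus (RingHom.ker s : Set Rt))
  Et : Fin m → Scheme.{u}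
  jt : ∀ i, Et i ⟶ Xt
  closedImmersion : ∀ i, IsClosedImmersion (jt i)
  surface_integral : ∀ i, IsIntegral (Et i)
  surface_dim : ∀ i, topologicalKrullDim (Et i) = 2
  surface_smooth : ∀ i, Smooth (jt i ≫ ft ≫ Spec.map (CommRingCat.ofHom (algebraMap Λ Rt)))
  preimage_section :
    ft ⁻¹' (PrimeSpectrum.zeroLocus (RingHom.ker s : Set Rt)) = ⋃ i, Set.range (jt i)
  normalCrossings : HasNormalCrossings jt
  /-- the closed fiber of `𝒳` is `X₀ = Spec R₀`, as a scheme over `k` -/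
  closedFiberEquiv :
    (Rt ⧸ (IsLocalRing.maximalIdeal Λ).map (algebraMap Λ Rt)) ≃+* R₀
  closedFiberEquiv_algebraMap : ∀ a : Λ,
    (closedFiberEquiv (Ideal.Quotient.mk _ (algebraMap Λ Rt a)) : R) =
      algebraMap k R (algebraMap Λ k a)
  /-- the closed fiber of the resolution of `𝒳` is `X₁ ⟶ X ⟶ X₀`, and it meets the surface `Et i` in
  the curve `E i` -/
  h : X₁ ⟶ Xt
  hE : ∀ i, E i ⟶ Et i
  isPullback_closedFiber :
    IsPullback h (f ≫ Spec.map (CommRingCat.ofHom R₀.subtype)) ft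
      (Spec.map (CommRingCat.ofHom (closedFiberEquiv.toRingHom.comp (Ideal.Quotient.mk _))))
  isPullback_component : ∀ i, IsPullback (hE i) (j i) (jt i) h

/-- The ideal of the image `S` of the section of an Artin family. -/
def ArtinFamily.I {k R Λ Rt : Type u}
    [Field k] [IsAlgClosed k] [CommRing R] [IsDomain R] [IsIntegrallyClosed R] [Algebra k R]
    [CommRing Λ] [IsDomain Λ] [IsDiscreteValuationRing Λ] [Algebra Λ k]
    [CommRing Rt] [IsDomain Rt] [IsIntegrallyClosed Rt] [IsNoetherianRing Rt] [IsLocalRing Rt]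
    [Algebra Λ Rt] (F : ArtinFamily k R Λ Rt) : Ideal Rt :=
  RingHom.ker F.s

end

end ArtinArcs

namespace ArtinArcs

/-! ### Evaluation of power series in complete rings -/

section Evaluation

open IsLocalRing

/-! Let `x` be a uniformizer of `Λ`. An arc in the closed fiber is a homomorphism `φ : Rt → K⟦t⟧`
with `φ x = 0`; the task is to deform it over `K⟦u⟧` so that `x ↦ u`, keeping the center on `S`.
Such a family leaves the closed fiber because `u ≠ 0`.

On a regular local ring `O` this is easy if `x` belongs to a regular system of parameters `x, y₁, …,
yᵣ`. In characteristic zero the completion of `O` has a coefficient field, and adjoining the `yᵢ` to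
it gives a subring `B` such that the completion is `B⟦x⟧`. Given a local `φ' : O → K⟦t⟧` with `φ' x
= 0`, let `B` act through `φ'` and send `x` to `u` (`exists_deformation`). The `yᵢ` keep their
images, so elements of `(y₁, …, yᵣ)` still vanish at `t = 0`.

To reach this situation, use the resolution. If the generic point of the arc is off `S`, the
valuative criterion lifts the arc to `Xt` (`exists_lift_of_isProper`). Its center lies on some `Et
i` and on the closed fiber, hence on `E i`. There `Et i` has one equation `g`, `x` is a
nonzerodivisor modulo `g` because `Et i` is flat over `Λ`, and modulo `(g, x)` one finds the regular
local ring of `E i`. So `g, x` extend to a regular system of parameters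
(`exists_regular_parameters`), and `I` maps into `(g)` because `Et i` is reduced and lies over `S`.
If the arc lies inside `S`, it factors through the section, and `O = Λ` does the job.

For arcs over the base, the coefficient field is chosen to contain a coefficient field of `Λ`; the
family then sends `Λ` into `K⟦u⟧`. Condition (NO) follows: a component over the closed point has a
generic arc over the base, and its deformation is a `K⟦u⟧`-point of the arc scheme specializing to
the generic point of the component but with `x ↦ u ≠ 0`, contradicting minimality
(`conditionNO_of_exists_isDeformation`). -/

theorem exists_adicCompletion_lift {R A : Type*} [CommRing R] [CommRing A] (V : Ideal R)
    (J : Ideal A) [IsAdicComplete J A] (e : R →+* A) (hV : V ≤ J.comap e) :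
    ∃ F : AdicCompletion V R →+* A, ∀ p, F (AdicCompletion.of V R p) = e p := by
  have hVn (n : ℕ) : V ^ n ≤ (J ^ n).comap e :=
    (Ideal.pow_right_mono hV n).trans (Ideal.le_comap_pow e n)
  let q (n : ℕ) : AdicCompletion V R →+* A ⧸ J ^ n :=
    (Ideal.quotientMap (J ^ n) e (hVn n)).comp (AdicCompletion.evalₐ V n).toRingHom
  have hq {m n : ℕ} (hle : m ≤ n) : (Ideal.Quotient.factorPow J hle).comp (q n) = q m := by
    ext z
    induction z using AdicCompletion.induction_on with
    | _ z =>
    have h := congrArg (Ideal.quotientMap (J ^ m) e (hVn m)) (AdicCompletion.Ideal.mk_eq_mk V hle z)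
    simpa [q] using h
  refine ⟨IsAdicComplete.liftRingHom J q hq, fun p => ?_⟩
  have hJ : IsHausdorff J A := inferInstance
  refine (IsHausdorff.eq_iff_smodEq (I := J)).2 fun n => ?_
  rw [SModEq.sub_mem, smul_eq_mul, Ideal.mul_top, ← Ideal.Quotient.eq]
  simp only [IsAdicComplete.mk_liftRingHom]
  simp [q]

/-- The power series ring in finitely many variables is the completion of the polynomial ring along
the variables, so polynomial evaluation extends to it. -/
theorem exists_mvPowerSeries_eval {σ B A : Type*} [Finite σ] [CommRing B] [CommRing A]
    (J : Ideal A) [IsAdicComplete J A] (β : B →+* A) (x : σ → A) (hx : ∀ i, x i ∈ J) :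
    ∃ ev : MvPowerSeries σ B →+* A,
      (∀ b, ev (MvPowerSeries.C b) = β b) ∧ ∀ i, ev (MvPowerSeries.X i) = x i := by
  obtain ⟨F, hF⟩ := exists_adicCompletion_lift (MvPolynomial.idealOfVars σ B) J
    (MvPolynomial.eval₂Hom β x) (by
      rw [Ideal.span_le]
      rintro _ ⟨i, rfl⟩
      simpa using hx i)
  refine ⟨F.comp (MvPowerSeries.toAdicCompletionAlgEquiv σ B).toRingEquiv.toRingHom, fun b => ?_,
    fun i => ?_⟩
  · have := MvPowerSeries.toAdicCompletion_coe (MvPolynomial.C b : MvPolynomial σ B)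
    rw [MvPolynomial.coe_C] at this
    refine (congrArg F this).trans ((hF _).trans ?_)
    simp
  · have := MvPowerSeries.toAdicCompletion_coe (MvPolynomial.X i : MvPolynomial σ B)
    rw [MvPolynomial.coe_X] at this
    refine (congrArg F this).trans ((hF _).trans ?_)
    simp

theorem exists_powerSeries_eval {B A : Type*} [CommRing B] [CommRing A]
    (J : Ideal A) [IsAdicComplete J A] (β : B →+* A) (x : A) (hx : x ∈ J) :
    ∃ ev : PowerSeries B →+* A, (∀ b, ev (PowerSeries.C b) = β b) ∧ ev PowerSeries.X = x := by
  obtain ⟨ev, h1, h2⟩ := exists_mvPowerSeries_eval (σ := Unit) J β (fun _ => x) fun _ => hx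
  exact ⟨ev, h1, h2 ()⟩

/-- A complete local ring with finitely generated maximal ideal and a coefficient field is
Noetherian. -/
theorem isNoetherianRing_of_coefficientField {κ A : Type*} [Field κ] [CommRing A] [IsLocalRing A]
    [IsAdicComplete (maximalIdeal A) A] (hfg : (maximalIdeal A).FG) (β : κ →+* A)
    (hβ : ∀ a, ∃ c, a - β c ∈ maximalIdeal A) : IsNoetherianRing A := by
  obtain ⟨s, hs⟩ := hfg
  obtain ⟨ev, h1, h2⟩ := exists_mvPowerSeries_eval (σ := s) (maximalIdeal A) β (fun i => i)
    fun i => hs ▸ Ideal.subset_span i.2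
  have hmap : (Ideal.span (Set.range (MvPowerSeries.X : s → MvPowerSeries s κ))).map ev =
      maximalIdeal A := by
    rw [Ideal.map_span, ← Set.range_comp, ← hs]
    congr 1
    ext a
    simp [h2]
  have hH : IsHausdorff ((Ideal.span (Set.range (MvPowerSeries.X : s → MvPowerSeries s κ))).map ev)
      A := by
    rw [hmap]; infer_instance
  -- The source is complete and the target separated, so surjectivity modulo the variables suffices;
  -- there the coefficient field already does it.
  have hsurj : Function.Surjective ev := by
    refine surjective_of_mk_map_comp_surjective
      (I := Ideal.span (Set.range (MvPowerSeries.X : s → MvPowerSeries s κ))) ev fun y => ?_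
    obtain ⟨a, rfl⟩ := Ideal.Quotient.mk_surjective y
    obtain ⟨c, hc⟩ := hβ a
    refine ⟨MvPowerSeries.C c, ?_⟩
    rw [RingHom.comp_apply, h1, eq_comm, Ideal.Quotient.eq, hmap]
    exact hc
  exact isNoetherianRing_of_surjective _ _ ev hsurj

end Evaluation

/-! ### Coefficient subrings -/

section CoefficientSubring

open IsLocalRing RingTheory.Sequence

/-- The subring `B` of `A` maps isomorphically onto `A ⧸ P`. -/
structure IsCoefficientSubring {A : Type*} [CommRing A] (B : Subring A) (P : Ideal A) : Prop where
  eq_zero : ∀ b ∈ B, b ∈ P → b = 0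
  exists_sub_mem : ∀ a, ∃ b ∈ B, a - b ∈ P

variable {A : Type*} [CommRing A]

/-- If `ev f ∈ P`, the constant coefficient of `f` lies in `B` and in `P + (x)`, so it vanishes.
Then `f = X f'`, and `x` can be cancelled modulo `P`; repeat with `f'`. -/
theorem IsCoefficientSubring.eval_injective_mod {B : Subring A} {P : Ideal A} {x : A}
    (hB : IsCoefficientSubring B (P ⊔ Ideal.span {x})) (hx : ∀ a, x * a ∈ P → a ∈ P)
    {ev : PowerSeries B →+* A} (hC : ∀ b, ev (PowerSeries.C b) = b) (hX : ev PowerSeries.X = x)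
    (f : PowerSeries B) (hf : ev f ∈ P) : f = 0 := by
  ext1 n
  rw [map_zero]
  induction n generalizing f with
  | zero =>
    have h := congrArg ev (PowerSeries.eq_shift_mul_X_add_const f)
    rw [map_add, map_mul, hC, hX] at h
    rw [PowerSeries.coeff_zero_eq_constantCoeff_apply]
    apply Subtype.ext
    refine hB.eq_zero _ (Subtype.prop _) ?_
    rw [eq_sub_of_add_eq' h.symm]
    exact sub_mem (Ideal.mem_sup_left hf) (Ideal.mem_sup_right
      (Ideal.mul_mem_left _ _ (Ideal.mem_span_singleton_self x)))
  | succ n ih =>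
    have h0 : PowerSeries.constantCoeff f = 0 := by
      have h := congrArg ev (PowerSeries.eq_shift_mul_X_add_const f)
      rw [map_add, map_mul, hC, hX] at h
      apply Subtype.ext
      refine hB.eq_zero _ (Subtype.prop _) ?_
      rw [eq_sub_of_add_eq' h.symm]
      exact sub_mem (Ideal.mem_sup_left hf) (Ideal.mem_sup_right
        (Ideal.mul_mem_left _ _ (Ideal.mem_span_singleton_self x)))
    obtain ⟨f', rfl⟩ := PowerSeries.X_dvd_iff.2 h0
    rw [map_mul, hX] at hf
    rw [mul_comm, PowerSeries.coeff_succ_mul_X]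
    exact ih f' (hx _ hf)

/-- `B⟦X⟧` is `X`-adically complete and `A ⧸ P` is `x`-adically separated by Krull's theorem, so it
is enough that `B` maps onto `A ⧸ (P + (x))`. -/
theorem IsCoefficientSubring.eval_surjective_mod [IsNoetherianRing A] [IsLocalRing A]
    {B : Subring A} {P : Ideal A} {x : A} (hxm : x ∈ maximalIdeal A)
    (hB : IsCoefficientSubring B (P ⊔ Ideal.span {x}))
    {ev : PowerSeries B →+* A} (hC : ∀ b, ev (PowerSeries.C b) = b) (hX : ev PowerSeries.X = x)
    (a : A) : ∃ f, a - ev f ∈ P := by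
  have hmap : (Ideal.span {(PowerSeries.X : PowerSeries B)}).map ((Ideal.Quotient.mk P).comp ev) =
      Ideal.span {Ideal.Quotient.mk P x} := by
    rw [Ideal.map_span, Set.image_singleton, RingHom.comp_apply, hX]
  have hH : IsHausdorff ((Ideal.span {(PowerSeries.X : PowerSeries B)}).map
      ((Ideal.Quotient.mk P).comp ev)) (A ⧸ P) := by
    have h1 : IsHausdorff (Ideal.span {x}) (A ⧸ P) :=
      IsHausdorff.of_isLocalRing _ _ fun h => by
        have : Ideal.span {x} ≤ maximalIdeal A := by simpa [Ideal.span_le] using hxm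
        exact (maximalIdeal.isMaximal A).ne_top (top_le_iff.1 (h ▸ this))
    rw [hmap]
    have := (IsHausdorff.map_algebraMap_iff (S := A ⧸ P) (M := A ⧸ P)
      (I := Ideal.span {x})).2 h1
    rwa [Ideal.map_span, Set.image_singleton] at this
  have hsurj : Function.Surjective ((Ideal.Quotient.mk P).comp ev) := by
    refine surjective_of_mk_map_comp_surjective
      (I := Ideal.span {(PowerSeries.X : PowerSeries B)}) _ fun y => ?_
    obtain ⟨y, rfl⟩ := Ideal.Quotient.mk_surjective y
    obtain ⟨a, rfl⟩ := Ideal.Quotient.mk_surjective y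
    obtain ⟨b, hb, hab⟩ := hB.exists_sub_mem a
    refine ⟨PowerSeries.C ⟨b, hb⟩, ?_⟩
    rw [RingHom.comp_apply, eq_comm, Ideal.Quotient.eq, hmap, RingHom.comp_apply, hC, ← map_sub]
    have := Ideal.mem_map_of_mem (Ideal.Quotient.mk P) hab
    rwa [Ideal.map_sup, Ideal.map_quotient_self, bot_sup_eq, Ideal.map_span,
      Set.image_singleton] at this
  obtain ⟨f, hf⟩ := hsurj (Ideal.Quotient.mk P a)
  exact ⟨f, Ideal.Quotient.eq.1 hf.symm⟩

/-- The new subring is the image of `B⟦X⟧` under `X ↦ x`; it maps isomorphically onto `A ⧸ P`. -/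
theorem IsCoefficientSubring.exists_adjoin [IsNoetherianRing A] [IsLocalRing A]
    [IsAdicComplete (maximalIdeal A) A] {B : Subring A} {P : Ideal A} {x : A}
    (hxm : x ∈ maximalIdeal A) (hB : IsCoefficientSubring B (P ⊔ Ideal.span {x}))
    (hx : ∀ a, x * a ∈ P → a ∈ P) :
    ∃ B' : Subring A, B ≤ B' ∧ x ∈ B' ∧ IsCoefficientSubring B' P := by
  obtain ⟨ev, hC, hX⟩ := exists_powerSeries_eval (maximalIdeal A) B.subtype x hxm
  refine ⟨ev.range, fun b hb => ⟨PowerSeries.C ⟨b, hb⟩, hC _⟩, ⟨_, hX⟩, ?_, fun a => ?_⟩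
  · rintro _ ⟨f, rfl⟩ hf
    rw [hB.eval_injective_mod hx hC hX f hf, map_zero]
  · obtain ⟨f, hf⟩ := hB.eval_surjective_mod hxm hC hX a
    exact ⟨_, ⟨f, rfl⟩, hf⟩

theorem mem_of_isWeaklyRegular_append {pre post : List A} {x : A}
    (h : IsWeaklyRegular A (pre ++ x :: post)) (a : A) (ha : x * a ∈ Ideal.ofList pre) :
    a ∈ Ideal.ofList pre := by
  rw [isWeaklyRegular_append_iff, isWeaklyRegular_cons_iff] at h
  have h' := h.2.1
  have key : (Submodule.Quotient.mk a : A ⧸ (Ideal.ofList pre • ⊤ : Submodule A A)) = 0 := by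
    apply h'
    change x • _ = x • _
    rw [smul_zero, ← Submodule.Quotient.mk_smul, Submodule.Quotient.mk_eq_zero]
    simpa using ha
  rw [Submodule.Quotient.mk_eq_zero] at key
  simpa using key

/-- In a complete Noetherian local ring, a coefficient field extends to coefficient rings modulo
the initial segments of a regular sequence of generators of the maximal ideal. -/
theorem IsCoefficientSubring.exists_of_isWeaklyRegular [IsNoetherianRing A] [IsLocalRing A]
    [IsAdicComplete (maximalIdeal A) A] {B₀ : Subring A} (post : List A) :
    ∀ pre : List A, IsWeaklyRegular A (pre ++ post) →
      (∀ x ∈ post, x ∈ maximalIdeal A) →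
      IsCoefficientSubring B₀ (Ideal.ofList (pre ++ post)) →
      ∃ B : Subring A, B₀ ≤ B ∧ (∀ x ∈ post, x ∈ B) ∧
        IsCoefficientSubring B (Ideal.ofList pre) := by
  induction post with
  | nil => exact fun pre _ _ h => ⟨B₀, le_rfl, by simp, by simpa using h⟩
  | cons x post ih =>
    intro pre hreg hmem h
    obtain ⟨B, hB₀, hpost, hB⟩ := ih (pre ++ [x]) (by simpa using hreg)
      (fun y hy => hmem y (List.mem_cons_of_mem _ hy)) (by simpa using h)
    rw [Ideal.ofList_append, Ideal.ofList_singleton] at hB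
    obtain ⟨B', hBB', hxB', hB'⟩ := hB.exists_adjoin (hmem x List.mem_cons_self)
      (mem_of_isWeaklyRegular_append hreg)
    refine ⟨B', hB₀.trans hBB', fun y hy => ?_, hB'⟩
    rcases List.mem_cons.1 hy with rfl | hy
    · exact hxB'
    · exact hBB' (hpost y hy)

/-- If `B` is a coefficient ring of the complete Noetherian local ring `A` modulo the nonzerodivisor
`x`, then every homomorphism `φ : A → T` with `φ x = 0` deforms to `A → T⟦u⟧` such that `x ↦ u`. -/
theorem IsCoefficientSubring.exists_deformation [IsNoetherianRing A] [IsLocalRing A]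
    [IsAdicComplete (maximalIdeal A) A] {B : Subring A} {x : A} (hxm : x ∈ maximalIdeal A)
    (hB : IsCoefficientSubring B (Ideal.span {x})) (hx : ∀ a, x * a = 0 → a = 0)
    {T : Type*} [CommRing T] (φ : A →+* T) (hφ : φ x = 0) :
    ∃ Φ : A →+* PowerSeries T, (∀ a, PowerSeries.constantCoeff (Φ a) = φ a) ∧
      Φ x = PowerSeries.X ∧ ∀ b ∈ B, Φ b = PowerSeries.C (φ b) := by
  obtain ⟨ev, hC, hX⟩ := exists_powerSeries_eval (maximalIdeal A) B.subtype x hxm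
  have hB' : IsCoefficientSubring B (⊥ ⊔ Ideal.span {x}) := by rwa [bot_sup_eq]
  have hinj : Function.Injective ev := (injective_iff_map_eq_zero ev).2 fun f hf =>
    hB'.eval_injective_mod (by simpa using hx) hC hX f (by simpa using hf)
  have hsurj : Function.Surjective ev := fun a => by
    obtain ⟨f, hf⟩ := hB'.eval_surjective_mod hxm hC hX a
    exact ⟨f, (sub_eq_zero.1 (by simpa using hf)).symm⟩
  -- Thus `A = B⟦x⟧`, and the deformation applies `φ` to the coefficients and renames `x` to `u`.
  let e : PowerSeries B ≃+* A := RingEquiv.ofBijective ev ⟨hinj, hsurj⟩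
  have he (f) : e.symm (ev f) = f := e.symm_apply_apply f
  refine ⟨(PowerSeries.map (φ.comp B.subtype)).comp e.symm.toRingHom, fun a => ?_, ?_,
    fun b hb => ?_⟩
  · obtain ⟨f, rfl⟩ := hsurj a
    have h := congrArg (φ.comp ev) (PowerSeries.eq_shift_mul_X_add_const f)
    simp only [RingHom.comp_apply, map_add, map_mul, hC, hX, hφ, mul_zero, zero_add] at h
    rw [h]
    have := PowerSeries.coeff_map (φ.comp B.subtype) 0 f
    rw [PowerSeries.coeff_zero_eq_constantCoeff_apply,
      PowerSeries.coeff_zero_eq_constantCoeff_apply] at this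
    change PowerSeries.constantCoeff (PowerSeries.map (φ.comp B.subtype) (e.symm (ev f))) = _
    rw [he, this]
    rfl
  · rw [← hX]
    simp [he]
  · have : b = ev (PowerSeries.C ⟨b, hb⟩) := by rw [hC]; rfl
    rw [RingHom.comp_apply]
    conv_lhs => rw [this]
    simp [he]

end CoefficientSubring

/-! ### Regular local rings -/

section Regular

open IsLocalRing RingTheory.Sequence

variable {C : Type*} [CommRing C]

theorem isLocalRing_quotient_span_singleton [IsLocalRing C] {x : C} (hx : x ∈ maximalIdeal C) :
    IsLocalRing (C ⧸ Ideal.span {x}) := by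
  have : Nontrivial (C ⧸ Ideal.span {x}) := Ideal.Quotient.nontrivial_iff.2 fun h => by
    rw [Ideal.span_singleton_eq_top] at h
    exact hx h
  exact IsLocalRing.of_surjective' _ Ideal.Quotient.mk_surjective

theorem maximalIdeal_quotient_eq_map [IsLocalRing C] {D : Type*} [CommRing D] [IsLocalRing D]
    (f : C →+* D) (hf : Function.Surjective f) :
    maximalIdeal D = (maximalIdeal C).map f := by
  have := hf.isLocalHom
  refine le_antisymm (fun d hd => ?_) (((local_hom_TFAE f).out 0 2).1 this)
  obtain ⟨c, rfl⟩ := hf d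
  exact Ideal.mem_map_of_mem f fun hc => hd (hc.map f)

/-- Write `x` in a minimal set of generators of the maximal ideal. As `x` is not in its square, some
coefficient is a unit, and that generator becomes redundant where `x` vanishes. -/
theorem spanFinrank_maximalIdeal_quotient_lt [IsLocalRing C] [IsNoetherianRing C] {x : C}
    (hx : x ∈ maximalIdeal C) (hx2 : x ∉ maximalIdeal C ^ 2) {D : Type*} [CommRing D]
    [IsLocalRing D] (f : C →+* D) (hf : Function.Surjective f) (hfx : f x = 0) :
    (maximalIdeal D).spanFinrank + 1 ≤ (maximalIdeal C).spanFinrank := by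
  classical
  obtain ⟨s, hcard, hs⟩ := Submodule.FG.exists_span_finset_card_eq_spanFinrank
    (maximalIdeal C).fg_of_isNoetherianRing
  rw [← hcard]
  have hx' := hx
  rw [← hs] at hx'
  obtain ⟨a, ha⟩ := Submodule.mem_span_finset'.1 hx'
  obtain ⟨i, hi⟩ : ∃ i, IsUnit (a i) := by
    by_contra! h
    apply hx2
    rw [← ha, pow_two]
    refine sum_mem fun i _ => Ideal.mul_mem_mul (h i) ?_
    rw [← hs]
    exact Submodule.subset_span i.2
  have hle : maximalIdeal D ≤ Ideal.span ((s.erase i).image f) := by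
    rw [maximalIdeal_quotient_eq_map f hf, ← hs, ← Ideal.span,
      Ideal.map_span, Ideal.span_le]
    rintro _ ⟨j, hj, rfl⟩
    have hmem (j : C) (hj : j ∈ s) (hji : j ≠ i) :
        f j ∈ Ideal.span (((s.erase i).image f : Finset D) : Set D) :=
      Ideal.subset_span (Finset.mem_coe.2 (Finset.mem_image_of_mem f
        (Finset.mem_erase.2 ⟨hji, hj⟩)))
    by_cases hji : j = i
    · have h := congrArg f ha
      rw [hfx, map_sum, ← Finset.add_sum_erase _ _ (Finset.mem_univ i)] at h
      have hu : IsUnit (f (a i)) := hi.map f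
      rw [SetLike.mem_coe, hji, ← Ideal.unit_mul_mem_iff_mem _ hu]
      rw [smul_eq_mul, map_mul] at h
      rw [eq_neg_of_add_eq_zero_left h]
      refine neg_mem (sum_mem fun k hk => ?_)
      rw [smul_eq_mul, map_mul]
      exact Ideal.mul_mem_left _ _ (hmem _ k.2 fun h => (Finset.mem_erase.1 hk).1 (Subtype.ext h))
    · exact hmem j hj hji
  have hD : maximalIdeal D = Ideal.span ((s.erase i).image f) := by
    refine le_antisymm hle ?_
    rw [Ideal.span_le]
    intro d hd
    obtain ⟨c, hc, rfl⟩ := Finset.mem_image.1 (Finset.mem_coe.1 hd)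
    rw [maximalIdeal_quotient_eq_map f hf]
    refine Ideal.mem_map_of_mem f ?_
    rw [← hs]
    exact Submodule.subset_span (Finset.mem_of_mem_erase hc)
  have h1 := Submodule.spanFinrank_span_le_ncard_of_finite (R := D)
    ((s.erase i).image f).finite_toSet
  rw [Set.ncard_coe_finset] at h1
  rw [hD]
  calc _ ≤ ((s.erase i).image f).card + 1 := Nat.add_le_add_right h1 1
    _ ≤ (s.erase i).card + 1 := Nat.add_le_add_right Finset.card_image_le 1
    _ = s.card := Finset.card_erase_add_one i.2

theorem exists_ringKrullDim_eq_natCast (C : Type*) [CommRing C] [IsLocalRing C]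
    [IsNoetherianRing C] : ∃ d : ℕ, ringKrullDim C = d := by
  have h1 := ringKrullDim_le_spanFinrank_maximalIdeal C
  have h2 := ringKrullDim_nonneg_of_nontrivial (R := C)
  generalize ringKrullDim C = w at h1 h2
  induction w using WithBot.recBotCoe with
  | bot => simp at h2
  | coe w =>
    cases w with
    | top => exact absurd (by exact_mod_cast h1) (ENat.natCast_lt_top _).not_ge
    | coe d => exact ⟨d, rfl⟩

/-- Dividing by `x` lowers the embedding dimension by at least one and the Krull dimension by at
most one; since the two agree on `C`, they agree on the quotient. -/
theorem isRegularLocalRing_quotient [IsRegularLocalRing C] {x : C} (hx : x ∈ maximalIdeal C)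
    (hx2 : x ∉ maximalIdeal C ^ 2) :
    IsRegularLocalRing (C ⧸ Ideal.span {x}) ∧
      ringKrullDim (C ⧸ Ideal.span {x}) + 1 = ringKrullDim C := by
  have := isLocalRing_quotient_span_singleton hx
  have h1 := spanFinrank_maximalIdeal_quotient_lt hx hx2 (Ideal.Quotient.mk (Ideal.span {x}))
    Ideal.Quotient.mk_surjective (Ideal.Quotient.eq_zero_iff_mem.2 (Ideal.mem_span_singleton_self x))
  have h2 := IsRegularLocalRing.spanFinrank_maximalIdeal (R := C)
  have h3 := ringKrullDim_le_spanFinrank_maximalIdeal (C ⧸ Ideal.span {x})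
  have h4 := ringKrullDim_le_ringKrullDim_quotient_add_card {x}
    (by simpa [IsLocalRing.ringJacobson_eq_maximalIdeal] using hx)
  rw [Finset.coe_singleton, Finset.card_singleton, ← h2] at h4
  obtain ⟨d, hd⟩ := exists_ringKrullDim_eq_natCast (C ⧸ Ideal.span {x})
  rw [hd] at h3 h4
  norm_cast at h3 h4
  refine ⟨IsRegularLocalRing.of_spanFinrank_maximalIdeal_le _ ?_, ?_⟩
  · rw [hd]; norm_cast; omega
  · rw [hd, ← h2]; norm_cast; omega

/-- Prime avoidance: otherwise the maximal ideal lies in its square, and is zero by Nakayama, or in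
a minimal prime. Both force dimension zero. -/
theorem exists_mem_maximalIdeal_not_mem [IsLocalRing C] [IsNoetherianRing C]
    (h : ringKrullDim C ≠ 0) :
    ∃ x ∈ maximalIdeal C, x ∉ maximalIdeal C ^ 2 ∧ ∀ p ∈ minimalPrimes C, x ∉ p := by
  classical
  by_contra! hcon
  have hfin : (minimalPrimes C).Finite := minimalPrimes.finite_of_isNoetherianRing C
  have hsub : ((maximalIdeal C : Ideal C) : Set C) ⊆
      ⋃ i ∈ ((insert (maximalIdeal C ^ 2) hfin.toFinset : Finset (Ideal C)) : Set (Ideal C)),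
        ((id i : Ideal C) : Set C) := by
    intro x hx
    simp only [Finset.coe_insert, Set.Finite.coe_toFinset, Set.mem_insert_iff,
      Set.iUnion_iUnion_eq_or_left, Set.mem_union, Set.mem_iUnion, id]
    by_cases hx2 : x ∈ maximalIdeal C ^ 2
    · exact Or.inl hx2
    · obtain ⟨p, hp, hxp⟩ := hcon x hx hx2
      exact Or.inr ⟨p, hp, hxp⟩
  -- Prime avoidance tolerates two ideals that are not prime; the square of the maximal ideal fills
  -- both places.
  rw [Ideal.subset_union_prime (maximalIdeal C ^ 2) (maximalIdeal C ^ 2)] at hsub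
  · obtain ⟨I, hI, hle⟩ := hsub
    rcases Finset.mem_insert.1 hI with rfl | hI
    · have hbot : maximalIdeal C = ⊥ := by
        refine Submodule.eq_bot_of_le_smul_of_le_jacobson_bot (maximalIdeal C) _
          (maximalIdeal C).fg_of_isNoetherianRing ?_ (IsLocalRing.maximalIdeal_le_jacobson _)
        rw [smul_eq_mul, ← pow_two]
        exact hle
      have hF : IsField C := IsLocalRing.isField_iff_maximalIdeal_eq.2 hbot
      exact h (ringKrullDim_eq_zero_of_isField hF)
    · rw [Set.Finite.mem_toFinset] at hI
      have hp : I.IsPrime := hI.1.1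
      have hm : I = maximalIdeal C := le_antisymm (le_maximalIdeal hp.ne_top) hle
      apply h
      rw [← maximalIdeal_height_eq_ringKrullDim, ← hm]
      have := Ideal.height_eq_zero_iff.2 hI
      rw [this]; rfl
  · intro I hI h1 _
    rcases Finset.mem_insert.1 hI with rfl | hI
    · exact absurd rfl h1
    · exact ((Set.Finite.mem_toFinset _).1 hI).1.1

/-- A minimal prime `p` inside the prime `(x)` does not contain `x`, hence `p = x p`, and `p = 0` by
Nakayama. -/
theorem isDomain_of_isDomain_quotient [IsLocalRing C] [IsNoetherianRing C] {x : C}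
    (hx : x ∈ maximalIdeal C) (hxp : ∀ p ∈ minimalPrimes C, x ∉ p)
    [IsDomain (C ⧸ Ideal.span {x})] : IsDomain C := by
  have hprime : (Ideal.span {x}).IsPrime := (Ideal.Quotient.isDomain_iff_prime _).1 inferInstance
  obtain ⟨p, hp, hle⟩ := Ideal.exists_minimalPrimes_le (I := (⊥ : Ideal C)) (J := Ideal.span {x})
    bot_le
  have hpp : p.IsPrime := hp.1.1
  have : p = ⊥ := by
    refine Submodule.eq_bot_of_le_smul_of_le_jacobson_bot (maximalIdeal C) _
      p.fg_of_isNoetherianRing (fun y hy => ?_) (IsLocalRing.maximalIdeal_le_jacobson _)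
    obtain ⟨c, rfl⟩ := Ideal.mem_span_singleton'.1 (hle hy)
    rw [mul_comm]
    exact Ideal.mul_mem_mul hx ((hpp.mem_or_mem hy).resolve_right (hxp p hp))
  rw [this] at hpp
  exact IsDomain.of_bot_isPrime C

open scoped Pointwise in
theorem isWeaklyRegular_cons_of_surjective {D : Type*} [CommRing D] (f : C →+* D)
    (hf : Function.Surjective f) {x : C} (hker : RingHom.ker f = Ideal.span {x})
    (hx : ∀ a, x * a = 0 → a = 0) {rs : List C} (h : IsWeaklyRegular D (rs.map f)) :
    IsWeaklyRegular C (x :: rs) := by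
  rw [isWeaklyRegular_cons_iff]
  refine ⟨isSMulRegular_iff_right_eq_zero_of_smul.2 hx, ?_⟩
  let _ := f.toAlgebra
  have h' := (isWeaklyRegular_map_algebraMap_iff (R := C) D D rs).1 h
  have hker' : LinearMap.ker (Algebra.linearMap C D) = (x • ⊤ : Submodule C C) := by
    rw [← Submodule.ideal_span_singleton_smul, ← hker]
    ext
    simp [RingHom.mem_ker, f.algebraMap_toAlgebra]
  refine (((Submodule.quotEquivOfEq _ _ hker').symm.trans
    (LinearMap.quotKerEquivOfSurjective (Algebra.linearMap C D) hf)).isWeaklyRegular_congr rs).2 h'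

theorem ofList_cons_eq_of_quotient [IsLocalRing C] {D : Type*} [CommRing D] [IsLocalRing D]
    (f : C →+* D) (hf : Function.Surjective f) {pre rs : List C}
    (hker : RingHom.ker f = Ideal.ofList pre)
    (h : Ideal.ofList (rs.map f) = maximalIdeal D) :
    Ideal.ofList (pre ++ rs) = maximalIdeal C := by
  have hloc := hf.isLocalHom
  rw [Ideal.ofList_append, ← hker]
  have := congrArg (Ideal.comap f) h
  rw [← Ideal.map_ofList, Ideal.comap_map_of_surjective' f hf, sup_comm] at this
  rw [this]
  exact ((local_hom_TFAE f).out 0 4).1 hloc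

/-- A regular local ring is a domain, and its maximal ideal is generated by a regular sequence. -/
theorem IsRegularLocalRing.isDomain_and_exists (n : ℕ) :
    ∀ (C : Type u) [CommRing C] [IsRegularLocalRing C], ringKrullDim C = n →
      IsDomain C ∧ ∃ rs : List C, IsWeaklyRegular C rs ∧ Ideal.ofList rs = maximalIdeal C := by
  induction n with
  | zero =>
    intro C _ _ hn
    have h := IsRegularLocalRing.spanFinrank_maximalIdeal (R := C)
    rw [hn] at h
    have hbot : maximalIdeal C = ⊥ :=
      (Submodule.spanFinrank_eq_zero_iff_eq_bot (maximalIdeal C).fg_of_isNoetherianRing).1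
        (by exact_mod_cast h)
    have hF : IsField C := IsLocalRing.isField_iff_maximalIdeal_eq.2 hbot
    exact ⟨hF.isDomain, [], IsWeaklyRegular.nil C C, by simp [hbot]⟩
  | succ n ih =>
    intro C _ _ hn
    obtain ⟨x, hx, hx2, hxp⟩ := exists_mem_maximalIdeal_not_mem (C := C) (by
      rw [hn]; norm_cast)
    obtain ⟨hreg, hdim⟩ := isRegularLocalRing_quotient hx hx2
    obtain ⟨hdom, rs', hrs', hgen⟩ := ih (C ⧸ Ideal.span {x}) (by
      rw [hn] at hdim
      obtain ⟨d, hd⟩ := exists_ringKrullDim_eq_natCast (C ⧸ Ideal.span {x})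
      rw [hd] at hdim ⊢
      norm_cast at hdim ⊢
      omega)
    obtain ⟨rs, rfl⟩ : ∃ rs : List C, rs.map (Ideal.Quotient.mk (Ideal.span {x})) = rs' :=
      ⟨rs'.map Quotient.out, by simp [Function.comp_def]⟩
    have hC := isDomain_of_isDomain_quotient hx hxp
    refine ⟨hC, x :: rs, isWeaklyRegular_cons_of_surjective _
      Ideal.Quotient.mk_surjective (Ideal.mk_ker) (fun a ha => ?_) hrs', ?_⟩
    · refine (mul_eq_zero.1 ha).resolve_left ?_
      rintro rfl
      exact hx2 (zero_mem _)
    · exact ofList_cons_eq_of_quotient (pre := [x]) _ Ideal.Quotient.mk_surjective (by simp) hgen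

end Regular

/-! ### Coefficient fields and deformations of arcs -/

section Deformation

open IsLocalRing RingTheory.Sequence

/-- `L` is algebraic, hence separable, over the purely transcendental extension generated by a
transcendence basis. -/
theorem formallySmooth_of_charZero (K L : Type*) [Field K] [Field L] [CharZero K] [Algebra K L] :
    Algebra.FormallySmooth K L := by
  obtain ⟨s, hs⟩ := exists_isTranscendenceBasis K L
  have := hs.isAlgebraic_field
  exact .of_algebraicIndependent_of_isSeparable hs.1

/-- A complete local algebra over a field of characteristic zero has a coefficient field containing
the image of that field. -/
theorem exists_coefficientField (k : Type*) {A : Type*} [Field k] [CharZero k] [CommRing A]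
    [IsLocalRing A] [IsAdicComplete (maximalIdeal A) A] [Algebra k A] :
    ∃ β : ResidueField A →+* A, (∀ c, residue A (β c) = c) ∧
      ∀ c : k, β (residue A (algebraMap k A c)) = algebraMap k A c := by
  have := formallySmooth_of_charZero k (ResidueField A)
  -- Formal smoothness lifts the identity of the residue field through all powers of the maximal
  -- ideal, and completeness gives the limit.
  obtain ⟨β, hβ⟩ := Algebra.FormallySmooth.exists_mkₐ_comp_eq_of_isAdicComplete
    (I := maximalIdeal A) (AlgHom.id k (ResidueField A))
  exact ⟨β.toRingHom, fun c => DFunLike.congr_fun hβ c, β.commutes⟩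

theorem isCoefficientSubring_range {A : Type*} [CommRing A] [IsLocalRing A]
    (β : ResidueField A →+* A) (hβ : ∀ c, residue A (β c) = c) :
    IsCoefficientSubring β.range (maximalIdeal A) := by
  refine ⟨?_, fun a => ⟨β (residue A a), ⟨_, rfl⟩, ?_⟩⟩
  · rintro _ ⟨c, rfl⟩ hc
    rw [← residue_eq_zero_iff, hβ] at hc
    rw [hc, map_zero]
  · rw [← residue_eq_zero_iff, map_sub, hβ, sub_self]

/-- Deformation of a homomorphism `φ : O → T` with `φ x = 0` to a homomorphism `O → T⟦u⟧` such that
`x ↦ u`, when `x` is part of a regular sequence generating the maximal ideal of `O`. -/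
theorem exists_deformation {O k T : Type*} [CommRing O] [IsLocalRing O] [IsNoetherianRing O]
    [Field k] [CharZero k] [Algebra k O] {x : O} {rs : List O} (hreg : IsWeaklyRegular O (x :: rs))
    (hgen : Ideal.ofList (x :: rs) = maximalIdeal O) [CommRing T] (J : Ideal T)
    [IsAdicComplete J T] (φ : O →+* T) (hφ : ∀ a ∈ maximalIdeal O, φ a ∈ J) (hφx : φ x = 0) :
    ∃ Φ : O →+* PowerSeries T, (∀ a, PowerSeries.constantCoeff (Φ a) = φ a) ∧
      Φ x = PowerSeries.X ∧ (∀ y ∈ rs, Φ y = PowerSeries.C (φ y)) ∧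
      ∀ c : k, Φ (algebraMap k O c) = PowerSeries.C (φ (algebraMap k O c)) := by
  let A := AdicCompletion (maximalIdeal O) O
  let ι : O →+* A := algebraMap O A
  obtain ⟨β, hβ, hβk⟩ := exists_coefficientField k (A := A)
  have hmA : maximalIdeal A = (maximalIdeal O).map ι := AdicCompletion.maximalIdeal_eq_map
  have hcoef := isCoefficientSubring_range β hβ
  -- The completion is a quotient of a power series ring over its coefficient field.
  have hnoeth : IsNoetherianRing A := by
    refine isNoetherianRing_of_coefficientField ?_ β fun a => ⟨residue A a, ?_⟩
    · rw [hmA]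
      exact (maximalIdeal O).fg_of_isNoetherianRing.map _
    · rw [← residue_eq_zero_iff, map_sub]
      exact sub_eq_zero.2 (hβ _).symm
  have hregA : IsWeaklyRegular A ((x :: rs).map ι) := hreg.of_flat
  have hgenA : Ideal.ofList ((x :: rs).map ι) = maximalIdeal A := by
    rw [← Ideal.map_ofList, hgen, hmA]
  have hmem : ∀ y ∈ x :: rs, ι y ∈ maximalIdeal A := fun y hy => by
    rw [hmA]
    exact Ideal.mem_map_of_mem _ (hgen ▸ Ideal.subset_span hy)
  -- Only `rs` is adjoined to the coefficient field; `x` is kept back as the variable to be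
  -- deformed.
  obtain ⟨B, hB₀, hrs, hB⟩ := IsCoefficientSubring.exists_of_isWeaklyRegular
    (B₀ := β.range) (rs.map ι) [ι x] hregA
    (fun y hy => by
      obtain ⟨z, hz, rfl⟩ := List.mem_map.1 hy
      exact hmem z (List.mem_cons_of_mem _ hz))
    (by
      have : [ι x] ++ rs.map ι = (x :: rs).map ι := rfl
      rw [this, hgenA]
      exact hcoef)
  obtain ⟨F, hF⟩ := exists_adicCompletion_lift (maximalIdeal O) J φ hφ
  have hFι (a : O) : F (ι a) = φ a := hF a
  rw [Ideal.ofList_singleton] at hB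
  obtain ⟨Φ, h1, h2, h3⟩ := hB.exists_deformation (hmem x List.mem_cons_self)
    (fun a ha => by
      have := mem_of_isWeaklyRegular_append (pre := []) hregA a (by simpa using ha)
      simpa using this) F
    (by rw [hFι, hφx])
  refine ⟨Φ.comp ι, fun a => by rw [RingHom.comp_apply, h1, hFι], h2, fun y hy => ?_, fun c => ?_⟩
  · rw [RingHom.comp_apply, h3 _ (hrs _ (List.mem_map_of_mem hy)), hFι]
  · have hc : ι (algebraMap k O c) = algebraMap k A c :=
      (IsScalarTower.algebraMap_apply k O A c).symm
    rw [RingHom.comp_apply, h3 _ (hB₀ ⟨_, (hβk c).trans hc.symm⟩), hFι]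

end Deformation

/-! ### Interchanging the variables of a power series in two variables -/

section Swap

/-- The ring homomorphism `K⟦t⟧⟦u⟧ → K⟦u⟧⟦t⟧` that interchanges the two variables. -/
noncomputable def swapVars (K : Type*) [CommRing K] :
    PowerSeries (PowerSeries K) →+* PowerSeries (PowerSeries K) where
  toFun f := PowerSeries.mk fun n => PowerSeries.mk fun m =>
    PowerSeries.coeff n (PowerSeries.coeff m f)
  map_zero' := by ext; simp
  map_add' f g := by ext; simp
  map_one' := by
    ext n m
    simp only [PowerSeries.coeff_mk, PowerSeries.coeff_one]
    split_ifs <;> simp_all [PowerSeries.coeff_one]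
  map_mul' f g := by
    ext n m
    simp only [PowerSeries.coeff_mk, PowerSeries.coeff_mul, map_sum]
    rw [Finset.sum_comm]

variable {K : Type*} [CommRing K]

@[simp]
theorem coeff_coeff_swapVars (f : PowerSeries (PowerSeries K)) (m n : ℕ) :
    PowerSeries.coeff m (PowerSeries.coeff n (swapVars K f)) =
      PowerSeries.coeff n (PowerSeries.coeff m f) := by
  simp [swapVars]

theorem swapVars_X : swapVars K PowerSeries.X = PowerSeries.C PowerSeries.X := by
  ext n m
  rw [coeff_coeff_swapVars, PowerSeries.coeff_X, PowerSeries.coeff_C]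
  split_ifs <;> simp_all [PowerSeries.coeff_one, PowerSeries.coeff_X]

theorem constantCoeff_swapVars_C (f : PowerSeries K) (hf : PowerSeries.constantCoeff f = 0) :
    PowerSeries.constantCoeff (swapVars K (PowerSeries.C f)) = 0 := by
  ext m
  rw [← PowerSeries.coeff_zero_eq_constantCoeff_apply, coeff_coeff_swapVars, PowerSeries.coeff_C]
  split_ifs <;> simp [hf]

theorem map_constantCoeff_swapVars (f : PowerSeries (PowerSeries K)) :
    PowerSeries.map (PowerSeries.constantCoeff (R := K)) (swapVars K f) =
      PowerSeries.constantCoeff f := by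
  ext n
  rw [PowerSeries.coeff_map, ← PowerSeries.coeff_zero_eq_constantCoeff_apply,
    coeff_coeff_swapVars, PowerSeries.coeff_zero_eq_constantCoeff_apply]

end Swap

/-! ### Families of arcs from deformations -/

section Families

open IsLocalRing RingTheory.Sequence

/-- In equal characteristic zero the ring contains `ℚ`, which serves as the base field for the
coefficient field. -/
theorem exists_residueField_section (A : Type*) [CommRing A] [IsLocalRing A]
    [IsAdicComplete (maximalIdeal A) A] [CharZero (ResidueField A)] :
    ∃ β : ResidueField A →+* A, ∀ c, residue A (β c) = c := by
  have h0 : CharZero (A ⧸ maximalIdeal A) := inferInstanceAs (CharZero (ResidueField A))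
  obtain ⟨_⟩ := (EqualCharZero.nonempty_algebraRat_iff A).2 fun (I : Ideal A) hI =>
    (Ideal.Quotient.factor (le_maximalIdeal hI)).charZero
  obtain ⟨β, hβ, -⟩ := exists_coefficientField ℚ (A := A)
  exact ⟨β, hβ⟩

variable {Λ R : Type u} [CommRing Λ] [IsLocalRing Λ] [CommRing R] [Algebra Λ R]

/-- The generic point of the arc alone gives this, because `K⟦t⟧` is a domain. -/
theorem eq_zero_of_arcImage_subset {K : Type u} [Field K] {φ : R →+* PowerSeries K}
    (h : arcImage φ ⊆ closedFiber Λ R) {a : Λ} (ha : a ∈ maximalIdeal Λ) :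
    φ (algebraMap Λ R a) = 0 := by
  have := h ⟨⟨⊥, Ideal.isPrime_bot⟩, rfl⟩
  have h2 : a ∈ (PrimeSpectrum.comap (algebraMap Λ R)
    (PrimeSpectrum.comap φ ⟨⊥, Ideal.isPrime_bot⟩)).asIdeal := by
    rw [Set.mem_singleton_iff.1 this]
    exact ha
  simpa using h2

/-- A family `R → K⟦u⟧⟦t⟧` of arcs that specializes to `φ` and is not contained in the closed
fiber. -/
structure IsDeformation (Λ : Type u) {R : Type u} [CommRing Λ] [CommRing R] [Algebra Λ R]
    (I : Ideal R) (x : Λ) {K : Type u} [Field K] (φ : R →+* PowerSeries K)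
    (Φ : R →+* PowerSeries (PowerSeries K)) : Prop where
  map_eq : ∀ r, PowerSeries.map (PowerSeries.constantCoeff (R := K)) (Φ r) = φ r
  center : ∀ r ∈ I, PowerSeries.constantCoeff (Φ r) = 0
  uniformizer : Φ (algebraMap Λ R x) = PowerSeries.C PowerSeries.X
  overBase : IsArcOverBase Λ φ → ∀ a : Λ, ∃ c, Φ (algebraMap Λ R a) = PowerSeries.C c

/-- If the arc `φ` factors through a regular local ring with suitable parameters, it deforms. -/
theorem exists_isDeformation [IsAdicComplete (maximalIdeal Λ) Λ] [CharZero (ResidueField Λ)]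
    {x : Λ} (hx : maximalIdeal Λ = Ideal.span {x}) {I : Ideal R}
    {K : Type u} [Field K] (φ : R →+* PowerSeries K)
    {O : Type u} [CommRing O] [IsLocalRing O] [IsNoetherianRing O] (ρ : R →+* O)
    {rs : List O} (hreg : IsWeaklyRegular O (ρ (algebraMap Λ R x) :: rs))
    (hgen : Ideal.ofList (ρ (algebraMap Λ R x) :: rs) = maximalIdeal O)
    (hI : ∀ r ∈ I, ρ r ∈ Ideal.ofList rs)
    (φ' : O →+* PowerSeries K) (hφ' : ∀ r, φ' (ρ r) = φ r)
    (hloc : ∀ a ∈ maximalIdeal O, PowerSeries.constantCoeff (φ' a) = 0)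
    (hφx : φ (algebraMap Λ R x) = 0) :
    ∃ Φ, IsDeformation Λ I x φ Φ := by
  obtain ⟨β, hβ⟩ := exists_residueField_section Λ
  -- This makes the coefficient field of the completion contain the image of that of `Λ`, which
  -- controls `Φ` on `Λ` below.
  let _ : Algebra (ResidueField Λ) O := ((ρ.comp (algebraMap Λ R)).comp β).toAlgebra
  obtain ⟨Φ, h1, h2, h3, h4⟩ := exists_deformation (k := ResidueField Λ) hreg hgen
    (Ideal.span {(PowerSeries.X : PowerSeries K)}) φ'
    (fun a ha => Ideal.mem_span_singleton.2 (PowerSeries.X_dvd_iff.2 (hloc a ha)))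
    (by rw [hφ', hφx])
  -- `Φ` takes values in `K⟦t⟧⟦u⟧`, whereas a family of arcs lives in `K⟦u⟧⟦t⟧`.
  refine ⟨(swapVars K).comp (Φ.comp ρ), fun r => ?_, fun r hr => ?_, ?_, fun hb a => ?_⟩
  · rw [RingHom.comp_apply, map_constantCoeff_swapVars, RingHom.comp_apply, h1, hφ']
  · have hle : Ideal.ofList rs ≤
        RingHom.ker ((PowerSeries.constantCoeff (R := PowerSeries K)).comp
          ((swapVars K).comp Φ)) := by
      rw [Ideal.ofList, Ideal.span_le]
      intro y hy
      rw [SetLike.mem_coe, RingHom.mem_ker, RingHom.comp_apply, RingHom.comp_apply, h3 y hy]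
      refine constantCoeff_swapVars_C _ (hloc y ?_)
      rw [← hgen]
      exact Ideal.subset_span (List.mem_cons_of_mem _ hy)
    exact hle (hI r hr)
  · rw [RingHom.comp_apply, RingHom.comp_apply, h2, swapVars_X]
  -- Each `u`-coefficient of the image of `a` is constant in `t`: write `a = β b + x a'`. The first
  -- term has no positive powers of `u`, and `x ↦ u` shifts the coefficients of `a'` by one.
  · have key (n : ℕ) : ∀ a : Λ, ∃ c : K,
        PowerSeries.coeff n (Φ (ρ (algebraMap Λ R a))) = PowerSeries.C c := by
      have hdec (a : Λ) : ∃ b a', a = β b + x * a' := by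
        have : a - β (residue Λ a) ∈ maximalIdeal Λ := by
          rw [← residue_eq_zero_iff, map_sub, hβ, sub_self]
        rw [hx] at this
        obtain ⟨a', ha'⟩ := Ideal.mem_span_singleton.1 this
        exact ⟨_, a', by rw [← ha']; ring⟩
      induction n with
      | zero =>
        intro a
        obtain ⟨c, hc⟩ := hb a
        refine ⟨c, ?_⟩
        rw [PowerSeries.coeff_zero_eq_constantCoeff_apply, h1, hφ', hc]
      | succ n ih =>
        intro a
        obtain ⟨b, a', rfl⟩ := hdec a
        obtain ⟨c, hc⟩ := ih a'
        refine ⟨c, ?_⟩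
        have h4b : Φ (ρ (algebraMap Λ R (β b))) = PowerSeries.C _ := h4 b
        rw [map_add, map_mul, map_add, map_mul, map_add, map_mul, h2, h4b, map_add, mul_comm,
          PowerSeries.coeff_succ_mul_X, hc, PowerSeries.coeff_C, if_neg n.succ_ne_zero, zero_add]
    choose c hc using fun n => key n a
    refine ⟨PowerSeries.mk c, ?_⟩
    ext n m
    rw [RingHom.comp_apply, coeff_coeff_swapVars, RingHom.comp_apply, hc, PowerSeries.coeff_C,
      PowerSeries.coeff_C]
    split_ifs <;> simp

theorem toLaurent_injective (K : Type u) [Field K] : Function.Injective (toLaurent K K) := by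
  refine (HahnSeries.ofPowerSeries_injective).comp ?_
  intro f g h
  ext n
  simpa using congrArg (PowerSeries.coeff n) h

theorem IsDeformation.exists_isDirectSpecialization {I : Ideal R} {x : Λ} (hx : x ∈ maximalIdeal Λ)
    {K : Type u} [Field K] {φ : R →+* PowerSeries K} (hφ : IsSArc I φ)
    {Φ : R →+* PowerSeries (PowerSeries K)} (h : IsDeformation Λ I x φ Φ) :
    ∃ (L : Type u) (_ : Field L) (_ : Algebra K L) (ψ : R →+* PowerSeries (LaurentSeries L)),
      IsDirectSpecialization I φ ψ ∧ ¬ arcImage ψ ⊆ closedFiber Λ R ∧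
      (IsArcOverBase Λ φ → IsArcOverBase Λ ψ) := by
  -- No field extension is needed: `L = K`.
  refine ⟨K, inferInstance, inferInstance, (PowerSeries.map (toLaurent K K)).comp Φ,
    ⟨hφ, fun r hr => ?_, Φ, RingHom.ext h.map_eq, rfl⟩, fun hsub => ?_, fun hb a => ?_⟩
  · rw [RingHom.comp_apply, ← PowerSeries.coeff_zero_eq_constantCoeff_apply,
      PowerSeries.coeff_map, PowerSeries.coeff_zero_eq_constantCoeff_apply, h.center r hr, map_zero]
  · have h0 := eq_zero_of_arcImage_subset hsub hx
    rw [RingHom.comp_apply, h.uniformizer, PowerSeries.map_C] at h0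
    have h1 := congrArg PowerSeries.constantCoeff h0
    rw [PowerSeries.constantCoeff_C, map_zero, map_eq_zero_iff _ (toLaurent_injective K)] at h1
    exact PowerSeries.X_ne_zero h1
  · obtain ⟨c, hc⟩ := h.overBase hb a
    exact ⟨_, by rw [RingHom.comp_apply, hc, PowerSeries.map_C]⟩

end Families

/-! ### Nice triples -/

section Nice

open IsLocalRing

/-- An `I`-adic Cauchy sequence has a limit for the maximal ideal. The limit is also `I`-adic
because each `A ⧸ I ^ n` is separated for the maximal ideal, i.e. `I ^ n` is closed. -/
theorem isAdicComplete_of_le_maximalIdeal {A : Type*} [CommRing A] [IsLocalRing A]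
    [IsNoetherianRing A] [IsAdicComplete (maximalIdeal A) A] {I : Ideal A}
    (hI : I ≤ maximalIdeal A) : IsAdicComplete I A where
  toIsHausdorff := IsHausdorff.of_isLocalRing _ _ fun h =>
    (maximalIdeal.isMaximal A).ne_top (top_le_iff.1 (h ▸ hI))
  toIsPrecomplete := ⟨fun f hf => by
    have hf' : ∀ {m n : ℕ}, m ≤ n → f m - f n ∈ I ^ m := fun hmn => by
      simpa [SModEq.sub_mem] using hf hmn
    obtain ⟨L, hL⟩ := IsPrecomplete.prec (I := maximalIdeal A) (M := A) inferInstance (f := f)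
      fun {m n} hmn => by
        rw [SModEq.sub_mem, smul_eq_mul, Ideal.mul_top]
        exact Ideal.pow_right_mono hI m (hf' hmn)
    refine ⟨L, fun n => ?_⟩
    rw [SModEq.sub_mem, smul_eq_mul, Ideal.mul_top, ← Ideal.Quotient.eq_zero_iff_mem]
    have hH : IsHausdorff (maximalIdeal A) (A ⧸ I ^ n) := inferInstance
    refine hH.haus _ fun m => ?_
    rw [SModEq.zero, ← Ideal.Quotient.mk_eq_mk]
    have h1 := hL (max m n)
    rw [SModEq.sub_mem, smul_eq_mul, Ideal.mul_top] at h1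
    have h2 : (Ideal.Quotient.mk (I ^ n) (f n - L) : A ⧸ I ^ n) =
        Ideal.Quotient.mk (I ^ n) (f (max m n) - L) := by
      rw [Ideal.Quotient.eq]
      simpa using hf' (le_max_right m n)
    rw [Ideal.Quotient.mk_eq_mk, h2]
    have h3 := Ideal.pow_le_pow_right (le_max_left m n) h1
    have h4 : Ideal.Quotient.mk (I ^ n) (f (max m n) - L) =
        (f (max m n) - L) • (1 : A ⧸ I ^ n) := by
      rw [Algebra.smul_def, mul_one]; rfl
    rw [h4]
    exact Submodule.smul_mem_smul h3 trivial⟩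

theorem bijective_mk_comp_algebraMap {Λ R : Type u} [CommRing Λ] [CommRing R] [Algebra Λ R]
    (s : R →ₐ[Λ] Λ) :
    Function.Bijective ((Ideal.Quotient.mk (RingHom.ker s)).comp (algebraMap Λ R)) := by
  refine ⟨(injective_iff_map_eq_zero _).2 fun a ha => ?_, fun y => ?_⟩
  · rw [RingHom.comp_apply, Ideal.Quotient.eq_zero_iff_mem, RingHom.mem_ker, s.commutes] at ha
    exact ha
  · obtain ⟨r, rfl⟩ := Ideal.Quotient.mk_surjective y
    refine ⟨s r, ?_⟩
    rw [RingHom.comp_apply, Ideal.Quotient.eq, RingHom.mem_ker, map_sub, s.commutes]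
    simp

end Nice

/-! ### Local rings of schemes over an affine scheme -/

section Stalks

open IsLocalRing

theorem exists_stalk_hom {D : Type u} [CommRing D] [IsLocalRing D] {X : Scheme.{u}}
    (l : Spec (CommRingCat.of D) ⟶ X) {x : X} (hx : l (closedPoint D) = x) :
    ∃ θ : X.presheaf.stalk x ⟶ CommRingCat.of D, IsLocalHom θ.hom ∧
      Spec.map θ ≫ X.fromSpecStalk x = l := by
  subst hx
  exact ⟨Scheme.stalkClosedPointTo l, inferInstance, Scheme.Spec_stalkClosedPointTo_fromSpecStalk l⟩

/-- The homomorphism from `R` to a local ring of a scheme over `Spec R`. -/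
noncomputable def toStalk {R : Type u} [CommRing R] {Y : Scheme.{u}}
    (q : Y ⟶ Spec (CommRingCat.of R)) (y : Y) : R →+* Y.presheaf.stalk y :=
  (Spec.preimage (Y.fromSpecStalk y ≫ q)).hom

variable {R : Type u} [CommRing R] {Y : Scheme.{u}} (q : Y ⟶ Spec (CommRingCat.of R))

theorem SpecMap_toStalk (y : Y) :
    Spec.map (CommRingCat.ofHom (toStalk q y)) = Y.fromSpecStalk y ≫ q :=
  Spec.map_preimage _

theorem hom_comp_toStalk {D : Type u} [CommRing D] {y : Y}
    (θ : Y.presheaf.stalk y ⟶ CommRingCat.of D) (f : R →+* D)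
    (h : Spec.map θ ≫ Y.fromSpecStalk y ≫ q = Spec.map (CommRingCat.ofHom f)) :
    θ.hom.comp (toStalk q y) = f := by
  rw [← SpecMap_toStalk, ← Spec.map_comp] at h
  exact congrArg CommRingCat.Hom.hom (Spec.map_injective h)

theorem stalkMap_comp_toStalk {P : Scheme.{u}} (h : P ⟶ Y) (p : P) :
    (h.stalkMap p).hom.comp (toStalk q (h p)) = toStalk (h ≫ q) p := by
  refine hom_comp_toStalk q (D := P.presheaf.stalk p) _ _ ?_
  rw [SpecMap_toStalk]
  exact Scheme.SpecMap_stalkMap_fromSpecStalk_assoc _ _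

theorem toStalk_SpecMap {S : Type u} [CommRing S] (f : S →+* R) (y : Y) :
    toStalk (q ≫ Spec.map (CommRingCat.ofHom f)) y = (toStalk q y).comp f := by
  have : Spec.map (CommRingCat.ofHom ((toStalk q y).comp f)) =
      Y.fromSpecStalk y ≫ q ≫ Spec.map (CommRingCat.ofHom f) := by
    rw [CommRingCat.ofHom_comp, Spec.map_comp, SpecMap_toStalk, Category.assoc]
  rw [toStalk, ← this, Spec.preimage_map]
  rfl

/-- The kernel on local rings of the base change of the closed immersion given by a surjective
ring homomorphism. -/
theorem ker_stalkMap_of_isPullback {C : Type u} [CommRing C] {P : Scheme.{u}} {h : P ⟶ Y}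
    {a : P ⟶ Spec (CommRingCat.of C)} {γ : R →+* C}
    (hP : IsPullback h a q (Spec.map (CommRingCat.ofHom γ))) (hγ : Function.Surjective γ) {w : R}
    (hker : RingHom.ker γ = Ideal.span {w}) (p : P) :
    Function.Surjective (h.stalkMap p).hom ∧
      RingHom.ker (h.stalkMap p).hom = Ideal.span {toStalk q (h p) w} := by
  have hc : IsClosedImmersion (Spec.map (CommRingCat.ofHom γ)) :=
    IsClosedImmersion.spec_of_surjective _ hγ
  have hcl : IsClosedImmersion h := MorphismProperty.of_isPullback hP.flip hc
  refine ⟨h.stalkMap_surjective p, ?_⟩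
  have hw : (h.stalkMap p).hom (toStalk q (h p) w) = 0 := by
    have h1 := DFunLike.congr_fun (stalkMap_comp_toStalk q h p) w
    rw [RingHom.comp_apply] at h1
    rw [h1, hP.w, toStalk_SpecMap, RingHom.comp_apply]
    have : γ w = 0 := by
      rw [← RingHom.mem_ker, hker]
      exact Ideal.mem_span_singleton_self w
    rw [this, map_zero]
  apply le_antisymm
  · have hwm : toStalk q (h p) w ∈ maximalIdeal (Y.presheaf.stalk (h p)) := fun hu => by
      have := hu.map (h.stalkMap p).hom
      rw [hw] at this
      exact not_isUnit_zero this
    -- For `ker ⊆ (w)`: as `w` vanishes in `D`, the morphism `Spec D ⟶ Y` factors through the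
    -- pullback `P`, with closed point going to `p`. So the quotient map to `D` factors through the
    -- stalk map, and its kernel `(w)` contains the kernel of the latter.
    let D := Y.presheaf.stalk (h p) ⧸ Ideal.span {toStalk q (h p) w}
    have hD : IsLocalRing D := isLocalRing_quotient_span_singleton hwm
    let mk : Y.presheaf.stalk (h p) →+* D := Ideal.Quotient.mk _
    have hle : RingHom.ker γ ≤ RingHom.ker (mk.comp (toStalk q (h p))) := by
      rw [hker, Ideal.span_le, Set.singleton_subset_iff, SetLike.mem_coe, RingHom.mem_ker,
        RingHom.comp_apply, Ideal.Quotient.eq_zero_iff_mem]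
      exact Ideal.mem_span_singleton_self _
    let δ : C →+* D := RingHom.liftOfSurjective γ hγ ⟨mk.comp (toStalk q (h p)), hle⟩
    have hδ : δ.comp γ = mk.comp (toStalk q (h p)) := RingHom.liftOfRightInverse_comp _ _ _ _
    have hcomm : (Spec.map (CommRingCat.ofHom mk) ≫ Y.fromSpecStalk (h p)) ≫ q =
        Spec.map (CommRingCat.ofHom δ) ≫ Spec.map (CommRingCat.ofHom γ) := by
      rw [Category.assoc, ← SpecMap_toStalk, ← Spec.map_comp, ← Spec.map_comp,
        ← CommRingCat.ofHom_comp, ← CommRingCat.ofHom_comp, hδ]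
    let l := hP.lift _ _ hcomm
    have hl : l ≫ h = Spec.map (CommRingCat.ofHom mk) ≫ Y.fromSpecStalk (h p) := hP.lift_fst _ _ _
    have hlp : l (closedPoint D) = p := by
      apply h.isClosedEmbedding.injective
      have hloc : IsLocalHom mk := Ideal.Quotient.mk_surjective.isLocalHom
      have h1 : Spec.map (CommRingCat.ofHom mk) (closedPoint D) = closedPoint _ :=
        IsLocalRing.comap_closedPoint mk
      refine (Scheme.Hom.comp_apply l h _).symm.trans ?_
      rw [hl]
      refine (Scheme.Hom.comp_apply _ _ _).trans ?_
      rw [h1]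
      exact Scheme.fromSpecStalk_closedPoint
    obtain ⟨θ, -, hθ⟩ := exists_stalk_hom l hlp
    have hmono : h.stalkMap p ≫ θ = CommRingCat.ofHom mk := by
      apply Spec.map_injective
      rw [← cancel_mono (Y.fromSpecStalk (h p)), ← hl, ← hθ, Spec.map_comp, Category.assoc,
        Category.assoc, Scheme.SpecMap_stalkMap_fromSpecStalk]
    intro o ho
    have h0 : mk o = 0 := by
      rw [← CommRingCat.hom_ofHom mk, ← hmono, CommRingCat.hom_comp, RingHom.comp_apply,
        (RingHom.mem_ker).1 ho, map_zero]
    exact Ideal.Quotient.eq_zero_iff_mem.1 h0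
  · rw [Ideal.span_le, Set.singleton_subset_iff]
    exact hw

/-- A germ killed by the stalk map comes from a section vanishing on a neighborhood of `z` in `Z`.
That neighborhood contains the trace of a neighborhood in `X`, to which the section is restricted.
-/
theorem idealAt_eq_ker {X Z : Scheme.{u}} (j : Z ⟶ X) [IsClosedImmersion j] (z : Z) :
    idealAt j (j z) = RingHom.ker (j.stalkMap z).hom := by
  apply le_antisymm
  · rw [idealAt, Ideal.span_le]
    rintro _ ⟨V, hx, a, ha, rfl⟩
    rw [SetLike.mem_coe, RingHom.mem_ker, Scheme.Hom.germ_stalkMap_apply, ha, map_zero]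
  · intro g hg
    obtain ⟨V, hx, a, rfl⟩ := TopCat.Presheaf.exists_germ_eq X.presheaf g
    rw [RingHom.mem_ker, Scheme.Hom.germ_stalkMap_apply,
      ← map_zero (Z.presheaf.germ (j ⁻¹ᵁ V) z hx).hom] at hg
    obtain ⟨W, hzW, iU, iV, hW⟩ := TopCat.Presheaf.germ_eq Z.presheaf z hx hx _ _ hg
    obtain ⟨V', hV', hVW⟩ := j.isClosedEmbedding.isInducing.isOpen_iff.1 W.2
    let V'' : X.Opens := V ⊓ ⟨V', hV'⟩
    have hxV'' : j z ∈ V'' := ⟨hx, by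
      change z ∈ j ⁻¹' V'
      rw [hVW]
      exact hzW⟩
    let i : V'' ⟶ V := homOfLE inf_le_left
    have hle : j ⁻¹ᵁ V'' ≤ W := fun y hy => by
      change y ∈ W.carrier
      rw [← hVW]
      exact hy.2
    refine Ideal.subset_span ⟨V'', hxV'', X.presheaf.map i.op a, ?_,
      TopCat.Presheaf.germ_res_apply _ _ _ _ _⟩
    have h1 := ConcreteCategory.congr_hom (j.naturality i.op) a
    refine h1.trans ?_
    have h2 : Z.presheaf.map ((TopologicalSpace.Opens.map j.base).map i).op =
        Z.presheaf.map iU.op ≫ Z.presheaf.map (homOfLE hle).op := by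
      rw [← Functor.map_comp]
      rfl
    change Z.presheaf.map ((TopologicalSpace.Opens.map j.base).map i).op (j.app V a) = 0
    rw [h2]
    refine (congrArg (Z.presheaf.map (homOfLE hle).op) hW).trans ?_
    rw [map_zero, map_zero]

/-- The stalk is flat over `Λ`, being flat over a localization of `Λ`, and nonzero elements of a
domain are regular on flat modules. -/
theorem mul_eq_zero_of_flat {Λ : Type u} [CommRing Λ] [IsDomain Λ] {Z : Scheme.{u}}
    (f : Z ⟶ Spec (CommRingCat.of Λ)) [Flat f] (z : Z) {w : Λ} (hw : w ≠ 0)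
    (o : Z.presheaf.stalk z) (ho : toStalk f z w * o = 0) : o = 0 := by
  have hflat : (toStalk f z).Flat := by
    have := stalkMap_comp_toStalk (𝟙 (Spec (CommRingCat.of Λ))) f z
    rw [Category.comp_id] at this
    rw [← this]
    refine RingHom.Flat.comp ?_ (Flat.stalkMap f z)
    have h1 : toStalk (𝟙 (Spec (CommRingCat.of Λ))) (f z) =
        (StructureSheaf.toStalk Λ (f z)).hom := by
      rw [toStalk, Category.comp_id, Spec.fromSpecStalk_eq']
      exact congrArg CommRingCat.Hom.hom (Spec.preimage_map _)
    rw [h1]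
    let p : PrimeSpectrum Λ := f z
    exact IsLocalization.flat (R := Λ)
      ((Spec.structureSheaf Λ).presheaf.stalk p) p.asIdeal.primeCompl
  let _ := (toStalk f z).toAlgebra
  have : Module.Flat Λ (Z.presheaf.stalk z) := hflat
  exact (Module.Flat.isSMulRegular_of_nonZeroDivisors
    (mem_nonZeroDivisors_of_ne_zero hw)).right_eq_zero_of_smul ho

/-- Elements of the ideal of a closed subset vanish on reduced schemes over it. -/
theorem toStalk_eq_zero_of_subset {Z : Scheme.{u}} (f : Z ⟶ Spec (CommRingCat.of R)) [IsReduced Z]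
    {I : Ideal R} (hI : ∀ z, f z ∈ PrimeSpectrum.zeroLocus (I : Set R)) (z : Z) {r : R}
    (hr : r ∈ I) : toStalk f z r = 0 := by
  -- The image of `r` lies in every prime of the stalk, which is reduced.
  refine IsNilpotent.eq_zero (nilpotent_iff_mem_prime.2 fun J hJ => ?_)
  have h1 : Spec.map (CommRingCat.ofHom (toStalk f z)) ⟨J, hJ⟩ ∈
      PrimeSpectrum.zeroLocus (I : Set R) := by
    rw [SpecMap_toStalk]
    exact (Scheme.Hom.comp_apply (Z.fromSpecStalk z) f _) ▸ hI _
  exact h1 hr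

/-- The generic point of `Spec A` maps into the open set over which `f` is invertible, so it lifts;
the existence half of the valuative criterion extends this lift. -/
theorem exists_lift_of_isProper {X : Scheme.{u}} {f : Y ⟶ X} [IsProper f] {Z : Set X}
    (hZ : IsClosed Z) (hf : IsIsoOff f Z) {A : Type u} [CommRing A] [IsDomain A] [ValuationRing A]
    (l : Spec (CommRingCat.of A) ⟶ X) (hl : l ⟨⊥, Ideal.isPrime_bot⟩ ∉ Z) :
    ∃ l' : Spec (CommRingCat.of A) ⟶ Y, l' ≫ f = l := by
  let V : X.Opens := ⟨Zᶜ, hZ.isOpen_compl⟩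
  have hV : IsIso (f ∣_ V) := hf V disjoint_compl_left
  let K := FractionRing A
  let η : Spec (CommRingCat.of K) ⟶ X := Spec.map (CommRingCat.ofHom (algebraMap A K)) ≫ l
  have hη : Set.range η ⊆ Set.range V.ι := by
    rw [Scheme.Opens.range_ι]
    rintro _ ⟨y, rfl⟩
    have hy : Spec.map (CommRingCat.ofHom (algebraMap A K)) y = ⟨⊥, Ideal.isPrime_bot⟩ := by
      have hbot : y.asIdeal = ⊥ := (Ideal.eq_bot_or_top _).resolve_right y.2.ne_top
      refine PrimeSpectrum.ext ?_
      change y.asIdeal.comap (algebraMap A K) = ⊥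
      rw [hbot]
      exact (RingHom.injective_iff_ker_eq_bot _).1 (IsFractionRing.injective A K)
    have h1 : η y = l (Spec.map (CommRingCat.ofHom (algebraMap A K)) y) :=
      Scheme.Hom.comp_apply _ _ _
    rw [h1, hy]
    exact hl
  let η' := IsOpenImmersion.lift V.ι η hη
  have hη' : η' ≫ V.ι = η := IsOpenImmersion.lift_fac _ _ _
  let i₁ : Spec (CommRingCat.of K) ⟶ Y := η' ≫ inv (f ∣_ V) ≫ (f ⁻¹ᵁ V).ι
  have hsq : CommSq i₁ (Spec.map (CommRingCat.ofHom (algebraMap A K))) f l := ⟨by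
    simp only [i₁, Category.assoc]
    rw [← morphismRestrict_ι, IsIso.inv_hom_id_assoc, hη']⟩
  have hex : ValuativeCriterion.Existence f := by
    have h : UniversallyClosed f := inferInstance
    rw [UniversallyClosed.eq_valuativeCriterion] at h
    exact h.1
  obtain ⟨⟨l', -, h2⟩⟩ := (hex ⟨A, K, i₁, l, hsq⟩).exists_lift
  exact ⟨l', h2⟩

theorem exists_preimage_of_isPullback {P X Z S : Scheme.{u}} {a : P ⟶ X} {b : P ⟶ Z} {f : X ⟶ S}
    {g : Z ⟶ S} (h : IsPullback a b f g) {x : X} {z : Z} (hxz : f x = g z) :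
    ∃ p, a p = x ∧ b p = z := by
  obtain ⟨p, h1, h2⟩ := Scheme.Pullback.exists_preimage_pullback x z hxz
  refine ⟨h.isoPullback.inv p, ?_, ?_⟩
  · rw [← h1, ← Scheme.Hom.comp_apply, h.isoPullback_inv_fst]
  · rw [← h2, ← Scheme.Hom.comp_apply, h.isoPullback_inv_snd]

end Stalks

/-! ### Deformations of arcs in an Artin family -/

section ArtinFamily

open IsLocalRing RingTheory.Sequence

/-- For use with `O`, `O₁`, `O₂` the local rings of `Xt`, `Et i` and `E i` at a common point.
Parameters of `O₂` are lifted to `O` and preceded by `g, w`. A regular sequence in a Noetherian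
local ring may be permuted, so `w` can be moved to the front. -/
theorem exists_regular_parameters {O O₁ O₂ : Type u} [CommRing O] [CommRing O₁] [CommRing O₂]
    [IsRegularLocalRing O] [IsLocalRing O₁] [IsRegularLocalRing O₂] (f : O →+* O₁) (f₁ : O₁ →+* O₂)
    (hf : Function.Surjective f) (hf₁ : Function.Surjective f₁) {g w : O} (hg : g ≠ 0)
    (hker : RingHom.ker f = Ideal.span {g}) (hker₁ : RingHom.ker f₁ = Ideal.span {f w})
    (hw : ∀ a, f w * a = 0 → a = 0) :
    ∃ rs : List O, g ∈ rs ∧ IsWeaklyRegular O (w :: rs) ∧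
      Ideal.ofList (w :: rs) = maximalIdeal O := by
  obtain ⟨n, hn⟩ := exists_ringKrullDim_eq_natCast O
  obtain ⟨n₂, hn₂⟩ := exists_ringKrullDim_eq_natCast O₂
  obtain ⟨hdom, -⟩ := IsRegularLocalRing.isDomain_and_exists n O hn
  obtain ⟨-, rs, hrs, hgen⟩ := IsRegularLocalRing.isDomain_and_exists n₂ O₂ hn₂
  obtain ⟨rs, rfl⟩ : ∃ rs' : List O, (rs'.map f).map f₁ = rs := by
    obtain ⟨rs₁, rfl⟩ := List.map_surjective_iff.2 hf₁ rs
    obtain ⟨rs', rfl⟩ := List.map_surjective_iff.2 hf rs₁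
    exact ⟨rs', rfl⟩
  have h1 := isWeaklyRegular_cons_of_surjective f₁ hf₁ hker₁ hw hrs
  have h2 : IsWeaklyRegular O (g :: w :: rs) := isWeaklyRegular_cons_of_surjective f hf hker
    (fun a ha => (mul_eq_zero.1 ha).resolve_left hg) h1
  have h3 := ofList_cons_eq_of_quotient f₁ hf₁ (pre := [f w]) (by simpa using hker₁) hgen
  have h4 : Ideal.ofList (g :: w :: rs) = maximalIdeal O :=
    ofList_cons_eq_of_quotient f hf (pre := [g]) (rs := w :: rs) (by simpa using hker) h3
  have hperm : (g :: w :: rs).Perm (w :: g :: rs) := List.Perm.swap _ _ _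
  refine ⟨g :: rs, List.mem_cons_self, isWeaklyRegular_of_perm_of_subset_maximalIdeal h2 hperm
    fun r hr => h4 ▸ Ideal.subset_span hr, ?_⟩
  rw [← h4]
  simp only [Ideal.ofList_cons]
  rw [sup_left_comm]

variable {k R Λ Rt : Type u}
    [Field k] [IsAlgClosed k]
    [CommRing R] [IsDomain R] [IsIntegrallyClosed R] [Algebra k R]
    [CommRing Λ] [IsDomain Λ] [IsDiscreteValuationRing Λ] [Algebra Λ k]
    [CommRing Rt] [IsDomain Rt] [IsIntegrallyClosed Rt] [IsNoetherianRing Rt] [IsLocalRing Rt]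
    [Algebra Λ Rt] (F : ArtinFamily k R Λ Rt)

/-- The homomorphism corresponding to the inclusion of the closed fiber of an Artin family. -/
noncomputable def ArtinFamily.toClosedFiber : Rt →+* F.R₀ :=
  F.closedFiberEquiv.toRingHom.comp (Ideal.Quotient.mk _)

theorem ArtinFamily.toClosedFiber_surjective : Function.Surjective F.toClosedFiber :=
  F.closedFiberEquiv.surjective.comp Ideal.Quotient.mk_surjective

theorem ArtinFamily.ker_toClosedFiber {x : Λ} (hx : maximalIdeal Λ = Ideal.span {x}) :
    RingHom.ker F.toClosedFiber = Ideal.span {algebraMap Λ Rt x} := by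
  have h : (maximalIdeal Λ).map (algebraMap Λ Rt) = Ideal.span {algebraMap Λ Rt x} := by
    rw [hx, Ideal.map_span, Set.image_singleton]
  rw [← h]
  ext r
  rw [RingHom.mem_ker, ArtinFamily.toClosedFiber, RingHom.comp_apply, ← Ideal.Quotient.eq_zero_iff_mem]
  exact F.closedFiberEquiv.map_eq_zero_iff

/-- Pasting the two squares makes `E i` the closed fiber of `Et i`, so its local rings are those of
`Et i` modulo the uniformizer. -/
theorem ArtinFamily.isPullback_component_closedFiber (i : Fin F.m) :
    IsPullback (F.hE i) (F.j i ≫ F.f ≫ Spec.map (CommRingCat.ofHom F.R₀.subtype))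
      (F.jt i ≫ F.ft) (Spec.map (CommRingCat.ofHom F.toClosedFiber)) :=
  ((F.isPullback_component i).flip.paste_horiz F.isPullback_closedFiber.flip).flip

theorem charZero_residueField_of_surjective {A K : Type*} [CommRing A] [IsLocalRing A] [Field K]
    [CharZero K] (f : A →+* K) (hf : Function.Surjective f) : CharZero (ResidueField A) := by
  have : IsLocalHom f := hf.isLocalHom
  exact (ResidueField.lift f).charZero

theorem constantCoeff_eq_zero_of_isLocalHom {O K : Type*} [CommRing O] [IsLocalRing O] [Field K]
    (θ : O →+* PowerSeries K) [IsLocalHom θ] {a : O} (ha : a ∈ maximalIdeal O) :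
    PowerSeries.constantCoeff (θ a) = 0 := by
  by_contra h
  exact ha (IsUnit.of_map θ a (PowerSeries.isUnit_iff_constantCoeff.2 (isUnit_iff_ne_zero.2 h)))

/-- An arc in the closed fiber that lifts to the resolution deforms. -/
theorem ArtinFamily.exists_isDeformation_of_lift [CharZero k] {x : Λ} (hx0 : x ≠ 0)
    (hx : maximalIdeal Λ = Ideal.span {x}) {K : Type u} [Field K] (φ : Rt →+* PowerSeries K)
    (hφ : IsSArc F.I φ) (hφx : φ (algebraMap Λ Rt x) = 0)
    (l : Spec (CommRingCat.of (PowerSeries K)) ⟶ F.Xt)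
    (hl : l ≫ F.ft = Spec.map (CommRingCat.ofHom φ)) : ∃ Φ, IsDeformation Λ F.I x φ Φ := by
  have := charZero_residueField_of_surjective (algebraMap Λ k) F.residueField
  have := F.complete_base
  have hpt : F.ft (l (closedPoint (PowerSeries K))) =
      Spec.map (CommRingCat.ofHom φ) (closedPoint (PowerSeries K)) := by
    rw [← hl]
    exact (Scheme.Hom.comp_apply _ _ _).symm
  have hmem (r : Rt) (hr : PowerSeries.constantCoeff (φ r) = 0) :
      r ∈ (Spec.map (CommRingCat.ofHom φ) (closedPoint (PowerSeries K))).asIdeal := by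
    change φ r ∈ maximalIdeal (PowerSeries K)
    intro hu
    rw [PowerSeries.isUnit_iff_constantCoeff, hr] at hu
    exact not_isUnit_zero hu
  obtain ⟨i, e, he⟩ : ∃ i e, F.jt i e = l (closedPoint (PowerSeries K)) := by
    have h : l (closedPoint (PowerSeries K)) ∈
        F.ft ⁻¹' (PrimeSpectrum.zeroLocus (RingHom.ker F.s : Set Rt)) := by
      change F.ft (l (closedPoint (PowerSeries K))) ∈
        PrimeSpectrum.zeroLocus (RingHom.ker F.s : Set Rt)
      rw [hpt]
      exact fun r hr => hmem r (hφ r hr)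
    rw [F.preimage_section] at h
    exact Set.mem_iUnion.1 h
  obtain ⟨z, hz⟩ : ∃ z, Spec.map (CommRingCat.ofHom F.toClosedFiber) z =
      F.ft (l (closedPoint (PowerSeries K))) := by
    have h := range_comap_of_surjective _ F.toClosedFiber F.toClosedFiber_surjective
    have h' : F.ft (l (closedPoint (PowerSeries K))) ∈
        PrimeSpectrum.zeroLocus (RingHom.ker F.toClosedFiber : Set Rt) := by
      rw [hpt, F.ker_toClosedFiber hx, PrimeSpectrum.zeroLocus_span]
      rintro _ rfl
      exact hmem _ (by rw [hφx, map_zero])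
    rw [← h] at h'
    exact h'
  have hP := F.isPullback_component_closedFiber i
  -- The center of the lifted arc lies on `Et i` and over `X₀`, hence on `E i`.
  obtain ⟨e', rfl, -⟩ := exists_preimage_of_isPullback hP (x := e) (z := z) (by
    rw [hz, ← he]
    exact Scheme.Hom.comp_apply _ _ _)
  obtain ⟨θ, hθloc, hθ⟩ := exists_stalk_hom l he.symm
  have hcl := F.closedImmersion i
  have hint := F.surface_integral i
  have hsm := F.surface_smooth i
  have hreg := F.resolution.regular (F.jt i (F.hE i e'))
  have hreg₂ := F.goodResolution.curve_regular i e'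
  obtain ⟨g, hg, hgind⟩ := F.normalCrossings (F.jt i (F.hE i e'))
  have hker := hg i ⟨_, rfl⟩
  rw [idealAt_eq_ker] at hker
  -- A member of a linearly independent family in the cotangent space is nonzero.
  have hg0 : (g i : F.Xt.presheaf.stalk (F.jt i (F.hE i e'))) ≠ 0 := fun h0 => by
    refine hgind.ne_zero ⟨i, ⟨_, rfl⟩⟩ ?_
    have : g i = 0 := Subtype.ext h0
    simp only [this, map_zero]
  obtain ⟨hsurj₁, hker₁⟩ := ker_stalkMap_of_isPullback _ hP F.toClosedFiber_surjective
    (F.ker_toClosedFiber hx) e'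
  let ρ := toStalk F.ft (F.jt i (F.hE i e'))
  have hρ (r : Rt) : ((F.jt i).stalkMap (F.hE i e')).hom (ρ r) =
      toStalk (F.jt i ≫ F.ft) (F.hE i e') r :=
    DFunLike.congr_fun (stalkMap_comp_toStalk F.ft (F.jt i) (F.hE i e')) r
  rw [← hρ] at hker₁
  obtain ⟨rs, hgrs, hreg, hgen⟩ := exists_regular_parameters _ _
    ((F.jt i).stalkMap_surjective (F.hE i e')) hsurj₁ hg0 hker hker₁ (fun a ha => by
      rw [hρ] at ha
      have h1 := toStalk_SpecMap (F.jt i ≫ F.ft) (algebraMap Λ Rt) (F.hE i e')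
      rw [Category.assoc] at h1
      have h2 := DFunLike.congr_fun h1 x
      rw [RingHom.comp_apply] at h2
      rw [← h2] at ha
      exact mul_eq_zero_of_flat _ _ hx0 a ha)
  refine exists_isDeformation hx φ ρ hreg hgen (fun r hr => ?_) θ.hom
    (fun r => DFunLike.congr_fun (hom_comp_toStalk F.ft θ φ ?_) r)
    (fun a ha => constantCoeff_eq_zero_of_isLocalHom θ.hom ha) hφx
  -- `Et i` is reduced and maps into `S`, so `I` vanishes on it; thus `I` is sent into `(g)`, which
  -- lies in the ideal of `rs`.
  · have h0 : toStalk (F.jt i ≫ F.ft) (F.hE i e') r = 0 := by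
      refine toStalk_eq_zero_of_subset _ (I := RingHom.ker F.s) (fun z => ?_) _ hr
      have hz : F.jt i z ∈ ⋃ i, Set.range (F.jt i) := Set.mem_iUnion.2 ⟨i, z, rfl⟩
      rw [← F.preimage_section] at hz
      have h1 : (F.jt i ≫ F.ft) z = F.ft (F.jt i z) := Scheme.Hom.comp_apply _ _ _
      rw [h1]
      exact hz
    rw [← hρ, ← RingHom.mem_ker, hker] at h0
    refine (Ideal.span_le.2 ?_ : Ideal.span {_} ≤ Ideal.ofList rs) h0
    rw [Set.singleton_subset_iff]
    exact Ideal.subset_span hgrs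
  · rw [← hl, ← hθ, Category.assoc]

/-- An arc contained in the section deforms. -/
theorem ArtinFamily.exists_isDeformation_of_le_ker [CharZero k] {x : Λ} (hx0 : x ≠ 0)
    (hx : maximalIdeal Λ = Ideal.span {x}) {K : Type u} [Field K] (φ : Rt →+* PowerSeries K)
    (hφ : F.I ≤ RingHom.ker φ) (hφx : φ (algebraMap Λ Rt x) = 0) :
    ∃ Φ, IsDeformation Λ F.I x φ Φ := by
  have := charZero_residueField_of_surjective (algebraMap Λ k) F.residueField
  have := F.complete_base
  have hs : F.s.toRingHom (algebraMap Λ Rt x) = x := F.s.commutes x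
  -- The arc factors through the section, and `Λ` is itself regular with parameter `x`; no further
  -- parameters remain.
  refine exists_isDeformation (O := Λ) (rs := []) hx φ F.s.toRingHom ?_ ?_ (fun r hr => ?_)
    (φ.comp (algebraMap Λ Rt)) (fun r => ?_) (fun a ha => ?_) hφx
  · rw [hs, isWeaklyRegular_singleton_iff]
    exact isSMulRegular_iff_right_eq_zero_of_smul.2
      fun a ha => (mul_eq_zero.1 ha).resolve_left hx0
  · rw [hs, hx, Ideal.ofList_singleton]
  · have : F.s.toRingHom r = 0 := hr
    rw [this]
    exact zero_mem _
  · have h : algebraMap Λ Rt (F.s r) - r ∈ F.I := by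
      rw [ArtinFamily.I, RingHom.mem_ker, map_sub, F.s.commutes]
      exact sub_self _
    have h' := hφ h
    rw [RingHom.mem_ker, map_sub, sub_eq_zero] at h'
    exact h'
  · rw [hx] at ha
    obtain ⟨b, rfl⟩ := Ideal.mem_span_singleton.1 ha
    rw [RingHom.comp_apply, map_mul, map_mul, hφx, zero_mul, map_zero]

theorem ArtinFamily.exists_isDeformation [CharZero k] {x : Λ} (hx0 : x ≠ 0)
    (hx : maximalIdeal Λ = Ideal.span {x}) {K : Type u} [Field K] (φ : Rt →+* PowerSeries K)
    (hφ : IsSArc F.I φ) (hφx : φ (algebraMap Λ Rt x) = 0) :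
    ∃ Φ, IsDeformation Λ F.I x φ Φ := by
  by_cases hker : F.I ≤ RingHom.ker φ
  · exact F.exists_isDeformation_of_le_ker hx0 hx φ hker hφx
  -- Some element of `I` survives under `φ`, i.e. the generic point of the arc is off `S`.
  · have := F.resolution.proper
    obtain ⟨l, hl⟩ := exists_lift_of_isProper (PrimeSpectrum.isClosed_zeroLocus _) F.isIsoOff
      (Spec.map (CommRingCat.ofHom φ)) fun h => hker fun r hr => h hr
    exact F.exists_isDeformation_of_lift hx0 hx φ hφ hφx l hl

end ArtinFamily

/-! ### Condition (NO) from deformations of generic arcs -/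

section ConditionNO

open IsLocalRing

/-- Condition (NO) follows from the existence of deformations. -/
theorem conditionNO_of_exists_isDeformation {Λ Rt : Type u} [CommRing Λ] [IsDomain Λ]
    [IsDiscreteValuationRing Λ] [CommRing Rt] [Algebra Λ Rt] {I : Ideal Rt} {x : Λ}
    (hx : maximalIdeal Λ = Ideal.span {x})
    (h : ∀ (K : Type u) [Field K] (φ : Rt →+* PowerSeries K), IsSArc I φ →
      φ (algebraMap Λ Rt x) = 0 → ∃ Φ, IsDeformation Λ I x φ Φ) :
    ConditionNO Λ Rt I := by
  intro Z hZ
  rw [← PrimeSpectrum.zeroLocus_minimalPrimes] at hZ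
  obtain ⟨p, hp, rfl⟩ := hZ
  have hpp : p.IsPrime := hp.1.1
  refine ⟨⟨p, hpp⟩, le_refl p, ?_⟩
  by_contra hne
  -- A nonzero prime of the discrete valuation ring `Λ` is its maximal ideal.
  have hxp : algebraMap Λ (ArcAlgebra Λ Rt I) x ∈ p := by
    let P := p.comap (algebraMap Λ (ArcAlgebra Λ Rt I))
    have hP : P.IsPrime := Ideal.IsPrime.comap _
    have hP0 : P ≠ ⊥ := fun hP0 => hne (PrimeSpectrum.ext hP0)
    have hPm : P = maximalIdeal Λ := eq_maximalIdeal (hP.isMaximal hP0)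
    have hxP : x ∈ P := by
      rw [hPm, hx]
      exact Ideal.mem_span_singleton_self x
    exact hxP
  -- The generic point of the component is a `K`-point of the arc scheme, i.e. an arc over the base
  -- to which the hypothesis applies.
  let K := FractionRing (ArcAlgebra Λ Rt I ⧸ p)
  let q : ArcAlgebra Λ Rt I →ₐ[Λ] K := IsScalarTower.toAlgHom Λ (ArcAlgebra Λ Rt I) K
  have hq (a) : q a = 0 ↔ a ∈ p := by
    have : q a = algebraMap (ArcAlgebra Λ Rt I ⧸ p) K (Ideal.Quotient.mk p a) :=
      IsScalarTower.algebraMap_apply (ArcAlgebra Λ Rt I) (ArcAlgebra Λ Rt I ⧸ p) K a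
    have hinj : Function.Injective (algebraMap (ArcAlgebra Λ Rt I ⧸ p) K) :=
      IsFractionRing.injective _ _
    rw [this]
    exact (map_eq_zero_iff (algebraMap (ArcAlgebra Λ Rt I ⧸ p) K) hinj).trans
      Ideal.Quotient.eq_zero_iff_mem
  have hqC (a : Λ) : (ArcAlgebra.toArc q).toRingHom (algebraMap Λ Rt a) =
      PowerSeries.C (algebraMap Λ K a) := ((ArcAlgebra.toArc q).commutes a).trans (by
    rw [PowerSeries.algebraMap_apply])
  obtain ⟨Φ, hΦ⟩ := h K (ArcAlgebra.toArc q).toRingHom (ArcAlgebra.toArc_center q) (by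
    have : algebraMap Λ K x = 0 := (q.commutes x).symm.trans ((hq _).2 hxp)
    rw [hqC, this, map_zero])
  choose c hc using hΦ.overBase fun a => ⟨algebraMap Λ K a, hqC a⟩
  let cHom : Λ →+* PowerSeries K := PowerSeries.constantCoeff.comp (Φ.comp (algebraMap Λ Rt))
  have hcHom (a : Λ) : cHom a = c a := by
    simp only [cHom, RingHom.comp_apply, hc, PowerSeries.constantCoeff_C]
  have hcK (a : Λ) : PowerSeries.constantCoeff (cHom a) = algebraMap Λ K a := by
    have := hΦ.map_eq (algebraMap Λ Rt a)
    rw [hc, PowerSeries.map_C, hqC] at this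
    rw [hcHom]
    exact PowerSeries.C_injective this
  -- This is not the structure inherited from `K`: the deformation moves the base too, sending `x`
  -- to `u`. With it the family is a `K⟦u⟧`-point of the arc scheme.
  let _ : Algebra Λ (PowerSeries K) := cHom.toAlgebra
  let Φ' : Rt →ₐ[Λ] PowerSeries (PowerSeries K) :=
    { Φ with
      commutes' := fun a => by
        rw [PowerSeries.algebraMap_apply, RingHom.algebraMap_toAlgebra, hcHom]
        exact hc a }
  let f : ArcAlgebra Λ Rt I →ₐ[Λ] PowerSeries K := ArcAlgebra.ofArc Φ' hΦ.center
  let f₀ : ArcAlgebra Λ Rt I →ₐ[Λ] K :=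
    { PowerSeries.constantCoeff.comp f.toRingHom with
      commutes' := fun a => (congrArg PowerSeries.constantCoeff (f.commutes a)).trans (hcK a) }
  have hf₀ : f₀ = q := by
    apply Ideal.Quotient.algHom_ext
    apply MvPolynomial.algHom_ext
    rintro ⟨n, r⟩
    have h1 := congrArg (PowerSeries.coeff n) (hΦ.map_eq r)
    rw [PowerSeries.coeff_map] at h1
    have h2 : f (ArcAlgebra.coeff I n r) = PowerSeries.coeff n (Φ r) :=
      ArcAlgebra.ofArc_coeff Φ' hΦ.center n r
    have h3 : PowerSeries.coeff n (ArcAlgebra.toArc q r) = q (ArcAlgebra.coeff I n r) := by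
      simp [ArcAlgebra.toArc]
    change PowerSeries.constantCoeff (f (ArcAlgebra.coeff I n r)) = q (ArcAlgebra.coeff I n r)
    rw [h2, h1]
    exact h3
  have hle : RingHom.ker f ≤ p := fun a ha => (hq a).1 (by
    rw [← hf₀]
    change PowerSeries.constantCoeff (f a) = 0
    rw [(RingHom.mem_ker).1 ha, map_zero])
  -- The kernel of `f` is a prime contained in the minimal prime `p`, so it equals `p` and contains
  -- `x`.
  have hfx : f (algebraMap Λ _ x) = 0 := hp.2 ⟨RingHom.ker_isPrime f, bot_le⟩ hle hxp
  rw [f.commutes] at hfx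
  have hX : cHom x = PowerSeries.X := by
    simp only [cHom, RingHom.comp_apply, hΦ.uniformizer, PowerSeries.constantCoeff_C]
  exact PowerSeries.X_ne_zero (hX.symm.trans hfx)

end ConditionNO

end ArtinArcs

theorem mainTheorem3 {k R Λ Rt : Type u}
    [Field k] [IsAlgClosed k] [CharZero k]
    [CommRing R] [IsDomain R] [IsIntegrallyClosed R] [Algebra k R]
    [CommRing Λ] [IsDomain Λ] [IsDiscreteValuationRing Λ] [Algebra Λ k]
    [CommRing Rt] [IsDomain Rt] [IsIntegrallyClosed Rt] [IsNoetherianRing Rt] [IsLocalRing Rt]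
    [Algebra Λ Rt] (F : ArtinArcs.ArtinFamily k R Λ Rt) :
    (∀ (K : Type u) [Field K] (φ : Rt →+* PowerSeries K), ArtinArcs.IsSArc F.I φ →
      ArtinArcs.arcImage φ ⊆ ArtinArcs.closedFiber Λ Rt →
      ∃ (L : Type u) (_ : Field L) (_ : Algebra K L) (ψ : Rt →+* PowerSeries (LaurentSeries L)),
        ArtinArcs.IsDirectSpecialization F.I φ ψ ∧
        ¬ ArtinArcs.arcImage ψ ⊆ ArtinArcs.closedFiber Λ Rt ∧
        (ArtinArcs.IsArcOverBase Λ φ → ArtinArcs.IsArcOverBase Λ ψ)) ∧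
    ArtinArcs.IsNiceTriple Λ Rt F.I ∧
    ArtinArcs.ConditionNO Λ Rt F.I := by
  obtain ⟨x, hx⟩ := IsDiscreteValuationRing.exists_irreducible Λ
  have hxm := hx.maximalIdeal_eq
  have hmem : x ∈ IsLocalRing.maximalIdeal Λ := by
    rw [hxm]
    exact Ideal.mem_span_singleton_self x
  refine ⟨fun K _ φ hφ hsub => ?_, ⟨inferInstance, inferInstance, ?_,
    ArtinArcs.bijective_mk_comp_algebraMap F.s⟩, ?_⟩
  · obtain ⟨Φ, hΦ⟩ := F.exists_isDeformation hx.ne_zero hxm φ hφ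
      (ArtinArcs.eq_zero_of_arcImage_subset hsub hmem)
    exact hΦ.exists_isDirectSpecialization hmem hφ
  · have := F.complete
    exact ArtinArcs.isAdicComplete_of_le_maximalIdeal
      (IsLocalRing.le_maximalIdeal (RingHom.ker_ne_top F.s))
  · exact ArtinArcs.conditionNO_of_exists_isDeformation hxm
      fun K _ φ hφ hφx => F.exists_isDeformation hx.ne_zero hxm φ hφ hφx
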